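/- \textbf{Consistency of the approximate second fundamental form.} Let $1\le d\le n$, let $\Omega\subset\mathbb R^n$ be open and let $\mathbb G_{d,n}$ be the Grassmannian of $d$-dimensional subspaces $S$ of $\mathbb R^n$, identified with the orthogonal projections $S=(S_{jk})$ onto them. A $d$-varifold $V$ in $\Omega$ is a non-negative Radon measure on $\Omega\times\mathbb G_{d,n}$; $\|V\|$ is its image under $(x,S)\mapsto x$, and $V=\|V\|\otimes\nu_x$ with probability measures $\nu_x$ on $\mathbb G_{d,n}$. $V$ is rectifiable if $V=\theta\mathcal H^d_{|M}\otimes\delta_{T_xM}$ for a countably $d$-rectifiable set $M\subset\Omega$ with approximate tangent spaces $T_xM$ and a multiplicity $\theta>0$ ($\mathcal H^d$-a.e. on $M$). Here $T_xM$ is the $d$-plane such that $r^{-d}\int_M\varphi(\frac{y-x}{r})\theta(y)\,d\mathcal H^d(y)\to\theta(x)\int_{T_xM}\varphi\,d\mathcal H^d$ as $r\to0^+$ for all $\varphi\in C_c(\mathbb R^n)$, for $\mathcal H^d$-a.e. $x\in M$. For $\phi\in C^1_c(\Omega)$ and $X\in C^1_c(\Omega,\mathbb R^n)$ set $\nabla^S\phi=S\nabla\phi$,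 $$\delta_{ijk}V(\phi)=\int S_{jk}\,\nabla^S\phi(y)\cdot e_i\,dV(y,S),\qquad \delta V(X)=\int \mathrm{div}_S X(y)\,dV(y,S).$$ $V$ has (locally) bounded variations if all $\delta_{ijk}V$, $1\le i,j,k\le n$, are signed Radon measures on $\Omega$. Then $\delta V$ is a vector-valued Radon measure, and one writes $\delta_{ijk}V=-\beta^V_{ijk}\|V\|+(\delta_{ijk}V)_s$ and $\delta V=-H^V\|V\|+\delta V_s$ with parts $(\cdot)_s$ singular with respect to $\|V\|$. Let $c^V(x)=\int S\,d\nu_x(S)$, let $A^V(x)$ be the solution $a$ of the linear system $a_{ijk}+c_{jk}\sum_q a_{qiq}=b_{ijk}$ $(1\le i,j,k\le n)$ with $c=c^V(x)$, $b=\beta^V(x)$, and let $B^{V,k}_{ij}=\frac12(A^V_{ijk}+A^V_{jik}-A^V_{kij})$. Let $\rho,\xi,\eta:[0,\infty)\to[0,\infty)$ be of class $C^1$ and vanish on $[1,\infty)$, with $\rho$ non-increasing, $\rho'(0)=0$, $\int_{\mathbb R^n}\rho(|x|)\,dx=1$, $\xi>0$ on $(0,1)$, $\int_{\mathbb R^n}\xi(|x|)\,dx=1$,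 and $\eta\not\equiv0$. Put $\rho_\epsilon(x)=\epsilon^{-n}\rho(|x|/\epsilon)$, similarly $\xi_\epsilon,\eta_\epsilon$, and $C_\rho=d\omega_d\int_0^1\rho(r)r^{d-1}dr$, $C_\xi=d\omega_d\int_0^1\xi(r)r^{d-1}dr$, where $\omega_d$ is the volume of the unit ball of $\mathbb R^d$. For $\epsilon>0$ and $x\in\Omega_\epsilon=\{x\in\Omega:\mathrm{dist}(x,\partial\Omega)>\epsilon\}$ set $\delta_{ijk}V*\rho_\epsilon(x)=\int S_{jk}\nabla^S\rho_\epsilon(y-x)\cdot e_i\,dV(y,S)$ and $$\beta^{V,\epsilon}_{ijk}(x)=-\frac{C_\xi}{C_\rho}\,\frac{\delta_{ijk}V*\rho_\epsilon(x)}{\|V\|*\xi_\epsilon(x)},\qquad c^{V,\epsilon}_{jk}(x)=\frac{(c^V_{jk}\|V\|)*\eta_\epsilon(x)}{\|V\|*\eta_\epsilon(x)},$$ let $A^{V,\epsilon}(x)$ be the solution of the above linear system with $c=c^{V,\epsilon}(x)$, $b=\beta^{V,\epsilon}(x)$, and let $B^{V,\epsilon}$ be obtained from $A^{V,\epsilon}$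 as $B^V$ from $A^V$. These quantities are said to be defined at $x$ if $x\in\Omega_\epsilon$, the integrals converge, both denominators are positive and the linear system has exactly one solution. There exist constants $C_1,C_2>0$ depending only on $n$ and $d$ such that, for all $\rho,\xi,\eta$ as above, all open $\Omega\subset\mathbb R^n$ and all rectifiable $d$-varifolds $V$ in $\Omega$ with (locally) bounded variations, the following holds for $\|V\|$-a.e. $x\in\Omega$: (i) the system defining $A^V(x)$ has exactly one solution; $\beta^{V,\epsilon}(x),c^{V,\epsilon}(x),A^{V,\epsilon}(x),B^{V,\epsilon}(x)$ are defined for all sufficiently small $\epsilon>0$, and converge as $\epsilon\to0^+$ to $\beta^V(x),c^V(x),A^V(x),B^V(x)$, respectively; (ii) for every $\epsilon>0$ for which they are defined, $$|A^{V,\epsilon}(x)-A^V(x)|\le C_1\,|\beta^{V,\epsilon}(x)-\beta^V(x)|+C_2\,|H^V(x)|\,|c^{V,\epsilon}(x)-c^V(x)|,$$ where $|H^V|$ is the Euclidean norm and $|\cdot|$ is the maximum of the absolute values of the entries for the other tensors. -/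

import Mathlib

open MeasureTheory Set Filter Topology
open scoped ENNReal NNReal

noncomputable section

namespace WeakCurvature

/-- Euclidean space `ℝⁿ`. -/
abbrev E (n : ℕ) : Type := EuclideanSpace ℝ (Fin n)

/-- The canonical basis vector `e_i` of `ℝⁿ`. -/
def e {n : ℕ} (i : Fin n) : E n := EuclideanSpace.single i (1 : ℝ)

/-- The Grassmannian `𝔾_{d,n}`: a `d`-dimensional subspace `S` of `ℝⁿ` is identified with the
orthogonal projection onto it. The metric is the one of the operator norm. -/
abbrev Grassmannian (d n : ℕ) : Type :=
  {S : E n →L[ℝ] E n // IsStarProjection S ∧ Module.finrank ℝ (LinearMap.range S.toLinearMap) = d}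

/-- The matrix entry `S_{jk}` of the orthogonal projection onto `S`. -/
def entry {d n : ℕ} (S : Grassmannian d n) (j k : Fin n) : ℝ := (S.1 (e k)) j

/-- The linear subspace `S ⊆ ℝⁿ` itself, as a set. -/
def plane {d n : ℕ} (S : Grassmannian d n) : Set (E n) := range S.1

/-- The tangential gradient `∇^S f (x) = Π_S (∇ f (x))`. -/
def tangentialGradient {d n : ℕ} (S : Grassmannian d n) (f : E n → ℝ) (x : E n) : E n :=
  S.1 (gradient f x)

/-- The tangential divergence `div_S X (x) = ∑ DX(x) τ_i · τ_i` (for an orthonormal basis `(τ_i)`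
of `S`), that is, the trace of `DX(x) ∘ Π_S`. -/
def tangentialDivergence {d n : ℕ} (S : Grassmannian d n) (X : E n → E n) (x : E n) : ℝ :=
  LinearMap.trace ℝ (E n) ((fderiv ℝ X x).comp S.1).toLinearMap

/-- `μ` is a non-negative Radon measure on the open set `Ω`. Such a measure is represented by its
extension by zero to `ℝⁿ`. -/
structure IsRadonOn {n : ℕ} (Ω : Set (E n)) (μ : Measure (E n)) : Prop where
  compl_null : μ Ωᶜ = 0
  compact_lt_top : ∀ K : Set (E n), IsCompact K → K ⊆ Ω → μ K < ∞

/-- A `d`-varifold in `Ω`: a non-negative Radon measure on `Ω × 𝔾_{d,n}`, represented by its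
extension by zero to `ℝⁿ × 𝔾_{d,n}` (as `𝔾_{d,n}` is compact, Radon means finite on the sets
`K × 𝔾_{d,n}` with `K ⊆ Ω` compact). -/
structure Varifold (d : ℕ) {n : ℕ} (Ω : Set (E n)) where
  measure : Measure (E n × Grassmannian d n)
  compl_null : measure (Ωᶜ ×ˢ univ) = 0
  compact_lt_top : ∀ K : Set (E n), IsCompact K → K ⊆ Ω → measure (K ×ˢ univ) < ∞

/-- `M` is countably `d`-rectifiable: `M ⊆ M₀ ∪ ⋃ⱼ Fⱼ(ℝᵈ)` with `ℋᵈ(M₀) = 0` and `Fⱼ` Lipschitz. -/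
def CountablyRectifiable (d : ℕ) {n : ℕ} (M : Set (E n)) : Prop :=
  ∃ F : ℕ → E d → E n, (∀ m, ∃ K : ℝ≥0, LipschitzWith K (F m)) ∧
    Measure.euclideanHausdorffMeasure d (M \ ⋃ m, range (F m)) = 0

/-- The measure `θ ℋᵈ|_M`. -/
def weightedHausdorff (d : ℕ) {n : ℕ} (M : Set (E n)) (θ : E n → ℝ≥0) : Measure (E n) :=
  ((Measure.euclideanHausdorffMeasure d).restrict M).withDensity (fun x => (θ x : ℝ≥0∞))

/-- `S` is the approximate tangent space at `x` of `M` with multiplicity `θ`: the blow-ups at `x`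
of `θ ℋᵈ|_M` converge weakly-* to `θ(x) ℋᵈ|_S`, that is
`r⁻ᵈ ∫_M φ((y - x)/r) θ(y) dℋᵈ(y) → θ(x) ∫_S φ dℋᵈ` as `r → 0⁺` for all `φ ∈ C_c(ℝⁿ)`. -/
def IsApproxTangentSpace {d n : ℕ} (M : Set (E n)) (θ : E n → ℝ≥0) (x : E n)
    (S : Grassmannian d n) : Prop :=
  ∀ φ : E n → ℝ, Continuous φ → HasCompactSupport φ →
    Tendsto (fun r : ℝ => (r ^ d)⁻¹ * ∫ y, φ (r⁻¹ • (y - x)) ∂(weightedHausdorff d M θ))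
      (𝓝[>] 0)
      (𝓝 ((θ x : ℝ) * ∫ y in plane S, φ y ∂(Measure.euclideanHausdorffMeasure d)))

/-- `L`, a distribution of order one on `Ω`, is a (signed) Radon measure: it is integration against
the difference `μ.1 - μ.2` of two non-negative Radon measures on `Ω`. -/
def IsRepresentedBy {n : ℕ} (Ω : Set (E n)) (L : (E n → ℝ) → ℝ)
    (μ : Measure (E n) × Measure (E n)) : Prop :=
  IsRadonOn Ω μ.1 ∧ IsRadonOn Ω μ.2 ∧
    ∀ φ : E n → ℝ, ContDiff ℝ 1 φ → HasCompactSupport φ → tsupport φ ⊆ Ω →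
      L φ = (∫ x, φ x ∂μ.1) - ∫ x, φ x ∂μ.2

/-- `L` is a (signed) Radon measure on `Ω`. -/
def IsRadonDistribution {n : ℕ} (Ω : Set (E n)) (L : (E n → ℝ) → ℝ) : Prop :=
  ∃ μ : Measure (E n) × Measure (E n), IsRepresentedBy Ω L μ

open Classical in
/-- The density `f` of the absolutely continuous part in the Radon-Nikodym decomposition
`L = f ν + L_s`, `L_s ⟂ ν`, of a signed Radon measure `L` on `Ω`. (Up to `ν`-null sets it does not
depend on the pair of measures representing `L`.) -/
def radonNikodymDensity {n : ℕ} (Ω : Set (E n)) (L : (E n → ℝ) → ℝ) (ν : Measure (E n))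
    (x : E n) : ℝ :=
  if h : IsRadonDistribution Ω L then
    (h.choose.1.rnDeriv ν x).toReal - (h.choose.2.rnDeriv ν x).toReal
  else 0

/-- `a` solves the linear system `a_{ijk} + c_{jk} ∑_q a_{qiq} = b_{ijk}`, `i, j, k = 1, …, n`. -/
def IsSystemSolution {n : ℕ} (c : Fin n → Fin n → ℝ) (b a : Fin n → Fin n → Fin n → ℝ) : Prop :=
  ∀ i j k, a i j k + c j k * ∑ q, a q i q = b i j k

open Classical in
/-- The unique solution of the system `a_{ijk} + c_{jk} ∑_q a_{qiq} = b_{ijk}`. -/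
def systemSolution {n : ℕ} (c : Fin n → Fin n → ℝ) (b : Fin n → Fin n → Fin n → ℝ) :
    Fin n → Fin n → Fin n → ℝ :=
  if h : ∃! a, IsSystemSolution c b a then h.choose else 0

/-- The tensor `B_{ij}^k = (A_{ijk} + A_{jik} - A_{kij}) / 2`, with arguments in the
order `i, j, k`. -/
def toB {n : ℕ} (A : Fin n → Fin n → Fin n → ℝ) : Fin n → Fin n → Fin n → ℝ :=
  fun i j k => (1 / 2 : ℝ) * (A i j k + A j i k - A k i j)

/-- The three profiles used for regularization. Only their values on `[0, ∞)` matter. -/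
structure IsKernelTriple (n : ℕ) (ρ ξ η : ℝ → ℝ) : Prop where
  rho_contDiff : ContDiffOn ℝ 1 ρ (Ici 0)
  xi_contDiff : ContDiffOn ℝ 1 ξ (Ici 0)
  eta_contDiff : ContDiffOn ℝ 1 η (Ici 0)
  rho_nonneg : ∀ t, 0 ≤ t → 0 ≤ ρ t
  xi_nonneg : ∀ t, 0 ≤ t → 0 ≤ ξ t
  eta_nonneg : ∀ t, 0 ≤ t → 0 ≤ η t
  rho_zero : ∀ t, 1 ≤ t → ρ t = 0
  xi_zero : ∀ t, 1 ≤ t → ξ t = 0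
  eta_zero : ∀ t, 1 ≤ t → η t = 0
  rho_antitone : AntitoneOn ρ (Ici 0)
  rho_deriv_zero : derivWithin ρ (Ici 0) 0 = 0
  rho_integral : ∫ x : E n, ρ ‖x‖ = 1
  xi_pos : ∀ t, 0 < t → t < 1 → 0 < ξ t
  xi_integral : ∫ x : E n, ξ ‖x‖ = 1
  eta_nontrivial : ∃ t, 0 ≤ t ∧ η t ≠ 0

/-- The rescaled radial kernel `ρ_ε(x) = ε⁻ⁿ ρ(|x|/ε)`. -/
def scaledKernel {n : ℕ} (ρ : ℝ → ℝ) (ε : ℝ) (x : E n) : ℝ := (ε ^ n)⁻¹ * ρ (‖x‖ / ε)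

/-- `ω_d`, the Lebesgue measure of the unit ball of `ℝᵈ`. -/
def unitBallVolume (d : ℕ) : ℝ := (volume (Metric.ball (0 : E d) 1)).toReal

/-- `C_ρ = d ω_d ∫₀¹ ρ(r) r^{d-1} dr`. -/
def kernelConstant (d : ℕ) (ρ : ℝ → ℝ) : ℝ :=
  d * unitBallVolume d * ∫ r in (0 : ℝ)..1, ρ r * r ^ (d - 1)

/-- `Ω_ε = {x ∈ Ω : dist(x, ∂Ω) > ε}` (with `dist(x, ∅) = ∞`). -/
def innerSet {n : ℕ} (Ω : Set (E n)) (ε : ℝ) : Set (E n) :=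
  {x ∈ Ω | ENNReal.ofReal ε < Metric.infEDist x (frontier Ω)}

/-- The convolution `μ ∗ κ (x) = ∫ κ(x - y) dμ(y)`. -/
def convolve {n : ℕ} (μ : Measure (E n)) (κ : E n → ℝ) (x : E n) : ℝ := ∫ y, κ (x - y) ∂μ

namespace Varifold

variable {d n : ℕ} {Ω : Set (E n)} (V : Varifold d Ω)

/-- The mass `‖V‖`, the image of `V` under `(x, S) ↦ x`. -/
def mass : Measure (E n) := V.measure.map Prod.fst

/-- `V = θ ℋᵈ|_M ⊗ δ_{T_x M}` is a rectifiable varifold: `M` is countably `d`-rectifiable, the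
multiplicity `θ` is positive `ℋᵈ`-a.e. on `M`, and `T x` is the approximate tangent
space `T_x M` at `ℋᵈ`-a.e. point `x` of `M`. -/
def IsRectifiable : Prop :=
  ∃ (M : Set (E n)) (θ : E n → ℝ≥0) (T : E n → Grassmannian d n),
    MeasurableSet M ∧ M ⊆ Ω ∧ CountablyRectifiable d M ∧ Measurable θ ∧ Measurable T ∧
    (∀ᵐ x ∂((Measure.euclideanHausdorffMeasure d).restrict M), 0 < θ x) ∧
    (∀ᵐ x ∂((Measure.euclideanHausdorffMeasure d).restrict M), IsApproxTangentSpace M θ x (T x)) ∧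
    V.measure = (weightedHausdorff d M θ).map (fun x => (x, T x))

open Classical ProbabilityTheory in
/-- The Young measures `{ν_x}`: a measurable family of probability measures on `𝔾_{d,n}` with
`V = ‖V‖ ⊗ ν_x`. (It exists for every `V`, and is unique up to `‖V‖`-null sets.) -/
def young : Kernel (E n) (Grassmannian d n) :=
  if h : ∃ ν : Kernel (E n) (Grassmannian d n),
      IsMarkovKernel ν ∧ V.measure = V.mass.compProd ν then h.choose else 0

/-- The first variation `δV(X) = ∫ div_S X(x) dV(x, S)`. -/
def firstVariation (X : E n → E n) : ℝ :=
  ∫ p, tangentialDivergence p.2 X p.1 ∂V.measure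

/-- The `G`-linear variation `δ_{ijk} V(φ) = ∫ S_{jk} ∇^S φ(y) · e_i dV(y, S)`. -/
def variation (i j k : Fin n) (φ : E n → ℝ) : ℝ :=
  ∫ p, entry p.2 j k * inner ℝ (tangentialGradient p.2 φ p.1) (e i) ∂V.measure

/-- `V` has (locally) bounded variations: each `δ_{ijk} V` is a signed Radon measure on `Ω`. -/
def HasBoundedVariations : Prop := ∀ i j k, IsRadonDistribution Ω (V.variation i j k)

/-- `β^V`, where `δ_{ijk} V = - β_{ijk} ‖V‖ + (δ_{ijk} V)_s`. -/
def beta (x : E n) : Fin n → Fin n → Fin n → ℝ :=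
  fun i j k => - radonNikodymDensity Ω (V.variation i j k) V.mass x

/-- `c^V(x) = ∫ S dν_x(S)`. -/
def c (x : E n) : Fin n → Fin n → ℝ := fun j k => ∫ S, entry S j k ∂(V.young x)

/-- The generalized mean curvature vector `H^V`, where `δV = - H ‖V‖ + δV_s`; the `i`-th component
of the vector measure `δV` is `φ ↦ δV(φ e_i)`. -/
def meanCurvature (x : E n) : E n :=
  WithLp.toLp 2 fun i =>
    - radonNikodymDensity Ω (fun φ => V.firstVariation (fun y => φ y • e i)) V.mass x

/-- The weak second fundamental form `A^V`. -/
def A (x : E n) : Fin n → Fin n → Fin n → ℝ := systemSolution (V.c x) (V.beta x)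

/-- The tensor `B^V`. -/
def B (x : E n) : Fin n → Fin n → Fin n → ℝ := toB (V.A x)

/-- The integrand `S_{jk} ∇^S ρ_ε(y - x) · e_i`, as a function of `(y, S)`. -/
def regVariationIntegrand (ρ : ℝ → ℝ) (ε : ℝ) (x : E n) (i j k : Fin n)
    (p : E n × Grassmannian d n) : ℝ :=
  entry p.2 j k * inner ℝ (tangentialGradient p.2 (scaledKernel ρ ε) (p.1 - x)) (e i)

/-- The regularized variation `δ_{ijk} V ∗ ρ_ε (x) = ∫ S_{jk} ∇^S ρ_ε(y - x) · e_i dV(y, S)`. -/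
def regVariation (ρ : ℝ → ℝ) (ε : ℝ) (i j k : Fin n) (x : E n) : ℝ :=
  ∫ p, regVariationIntegrand ρ ε x i j k p ∂V.measure

/-- `β^{V,ε}_{ijk} = - (C_ξ / C_ρ) (δ_{ijk} V ∗ ρ_ε) / (‖V‖ ∗ ξ_ε)`. -/
def betaReg (ρ ξ : ℝ → ℝ) (ε : ℝ) (x : E n) : Fin n → Fin n → Fin n → ℝ :=
  fun i j k => - (kernelConstant d ξ / kernelConstant d ρ) *
    (V.regVariation ρ ε i j k x / convolve V.mass (scaledKernel ξ ε) x)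

/-- `c^{V,ε}_{jk} = ((∫ S_{jk} dν_·(S)) ‖V‖ ∗ η_ε) / (‖V‖ ∗ η_ε)`. -/
def cReg (η : ℝ → ℝ) (ε : ℝ) (x : E n) : Fin n → Fin n → ℝ :=
  fun j k => (∫ y, scaledKernel η ε (x - y) * V.c y j k ∂V.mass) /
    convolve V.mass (scaledKernel η ε) x

/-- The approximate second fundamental form `A^{V,ε}`. -/
def AReg (ρ ξ η : ℝ → ℝ) (ε : ℝ) (x : E n) : Fin n → Fin n → Fin n → ℝ :=
  systemSolution (V.cReg η ε x) (V.betaReg ρ ξ ε x)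

/-- The tensor `B^{V,ε}`. -/
def BReg (ρ ξ η : ℝ → ℝ) (ε : ℝ) (x : E n) : Fin n → Fin n → Fin n → ℝ :=
  toB (V.AReg ρ ξ η ε x)

/-- The quantities `β^{V,ε}, c^{V,ε}, A^{V,ε}, B^{V,ε}` are defined at `x`: the point lies in `Ω_ε`,
all integrals converge, the denominators are positive and the linear system that determines
`A^{V,ε}` has exactly one solution. -/
structure RegularizationDefined (ρ ξ η : ℝ → ℝ) (ε : ℝ) (x : E n) : Prop where
  mem_innerSet : x ∈ innerSet Ω ε
  integrable_variation : ∀ i j k, Integrable (regVariationIntegrand ρ ε x i j k) V.measure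
  integrable_xi : Integrable (fun y => scaledKernel ξ ε (x - y)) V.mass
  integrable_eta : Integrable (fun y => scaledKernel η ε (x - y)) V.mass
  integrable_c : ∀ j k, Integrable (fun y => scaledKernel η ε (x - y) * V.c y j k) V.mass
  xi_pos : 0 < convolve V.mass (scaledKernel ξ ε) x
  eta_pos : 0 < convolve V.mass (scaledKernel η ε) x
  existsUnique : ∃! a, IsSystemSolution (V.cReg η ε x) (V.betaReg ρ ξ ε x) a

end Varifold

end WeakCurvature

end

/-!
The proof works at a point `x` with an approximate tangent space and rests on four facts.

* Differentiation. By Besicovitch, the ratio `μ(B(x, r)) / ‖V‖(B(x, r))` tends to the density of `μ`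
  with respect to `‖V‖`, for almost every `x` and every Radon measure `μ` on `Ω`. The superlevel
  sets of a radially decreasing kernel are balls, so by the layer cake formula
  (`lintegral_radial_le_of_closedBall_le`) balls may be replaced with the kernel `ρ_ε`
  (`IsProfile.tendsto_convolve_div_convolve`). Hence `δ_{ijk} V ∗ ρ_ε / (‖V‖ ∗ ρ_ε)` tends to
  `-β_{ijk}` (`IsRadonDistribution.ae_tendsto_div`).
* Tangent planes. Testing the blow-ups with radial functions gives
  `ε^(n-d) (‖V‖ ∗ κ_ε)(x) → θ(x) C_κ` for every profile `κ`. Thus `‖V‖ ∗ ρ_ε` may be exchanged for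
  `‖V‖ ∗ ξ_ε` at the price of the factor `C_ρ / C_ξ`, and `‖V‖ ∗ η_ε` dominates the mass of small
  balls, so that `c^{V,ε}` converges at Lebesgue points of the tangent plane
  (`IsProfile.tendsto_convolve_mul_div`), even though `η` need not be monotone.
* Algebra. Taking the partial trace `h_i = ∑_q a_{qiq}` of the system gives `(1 + c) h = tr b`. As
  `c` is an average of projections, it is accretive, `(1 + c)⁻¹` is a contraction, and the system is
  uniquely solvable with a Lipschitz bound that involves only `n` and `|tr b|`
  (`IsSystemSolution.norm_sub_le_of_isAccretive`).
* Mean curvature. As `S² = S`, one has `∑_q δ_{qiq} V(φ) = δV(φ e_i)`, whence `tr β^V = H^V` almost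
  everywhere. Densities being limits of mollifications, this passes from the distributions to
  their densities without comparing the measures that represent them.
-/

noncomputable section

namespace WeakCurvature

open Metric

/-! ### Radon measures on an open set and their differentiation -/

section Radon

variable {n : ℕ} {Ω : Set (E n)} {μ ν : Measure (E n)}

theorem IsRadonOn.sigmaFinite (hΩ : IsOpen Ω) (h : IsRadonOn Ω μ) : SigmaFinite μ := by
  obtain ⟨F, hFc, hFs, hFU, -⟩ := hΩ.exists_iUnion_isClosed
  have hlt (m k : ℕ) : μ (F m ∩ closedBall 0 k) < ∞ :=
    h.compact_lt_top _ ((isCompact_closedBall 0 (k : ℝ)).inter_left (hFc m))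
      (inter_subset_left.trans (hFs m))
  refine (Measure.FiniteSpanningSetsIn.mk (C := univ)
    (fun m : ℕ => (F m.unpair.1 ∩ closedBall 0 (m.unpair.2 : ℝ)) ∪ Ωᶜ) (fun _ => trivial)
    (fun m => ?_) ?_).sigmaFinite
  · refine (measure_union_le _ _).trans_lt ?_
    rw [h.compl_null, add_zero]
    exact hlt _ _
  · refine eq_univ_of_forall fun x => ?_
    by_cases hx : x ∈ Ω
    · rw [← hFU] at hx
      obtain ⟨m, hm⟩ := mem_iUnion.1 hx
      obtain ⟨k, hk⟩ := exists_nat_ge ‖x‖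
      refine mem_iUnion.2 ⟨Nat.pair m k, Or.inl ?_⟩
      simpa using ⟨hm, hk⟩
    · exact mem_iUnion.2 ⟨0, Or.inr hx⟩

theorem IsRadonOn.isFiniteMeasure_restrict (h : IsRadonOn Ω μ) {x : E n} {r : ℝ}
    (hr : closedBall x r ⊆ Ω) : IsFiniteMeasure (μ.restrict (closedBall x r)) :=
  ⟨by simpa using h.compact_lt_top _ (isCompact_closedBall x r) hr⟩

/-- A property holds almost everywhere as soon as it holds almost everywhere on every ball whose
closure lies in `Ω`. -/
theorem ae_of_ae_restrict_closedBall (hΩ : IsOpen Ω) (hμ : μ Ωᶜ = 0) {P : E n → Prop}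
    (h : ∀ x₀ r, 0 < r → closedBall x₀ r ⊆ Ω →
      ∀ᵐ x ∂(μ.restrict (closedBall x₀ r)), x ∈ ball x₀ r → P x) : ∀ᵐ x ∂μ, P x := by
  have key : μ ({x | ¬ P x} ∩ Ω) = 0 := by
    refine measure_null_of_locally_null _ fun x hx => ?_
    obtain ⟨r, hr, hrΩ⟩ := nhds_basis_closedBall.mem_iff.1 (hΩ.mem_nhds hx.2)
    refine ⟨_, inter_mem self_mem_nhdsWithin (mem_nhdsWithin_of_mem_nhds (ball_mem_nhds x hr)), ?_⟩
    have h1 := (ae_restrict_iff' measurableSet_closedBall).1 (h x r hr hrΩ)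
    refine measure_mono_null ?_ h1
    rintro y ⟨⟨hy, -⟩, hyb⟩ hh
    exact hy (hh (ball_subset_closedBall hyb) hyb)
  refine measure_mono_null (t := ({x | ¬ P x} ∩ Ω) ∪ Ωᶜ) ?_ (measure_union_null key hμ)
  intro x hx
  by_cases hxΩ : x ∈ Ω
  · exact Or.inl ⟨hx, hxΩ⟩
  · exact Or.inr hxΩ

theorem rnDeriv_restrict_restrict (μ ν : Measure (E n)) [SigmaFinite μ] [SigmaFinite ν]
    {K : Set (E n)} (hK : MeasurableSet K) :
    (μ.restrict K).rnDeriv (ν.restrict K) =ᵐ[ν.restrict K] μ.rnDeriv ν := by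
  refine (Measure.eq_rnDeriv (s := (μ.singularPart ν).restrict K) (Measure.measurable_rnDeriv _ _)
    ?_ ?_).symm
  · exact ((Measure.mutuallySingular_singularPart μ ν).mono Measure.restrict_le_self
      Measure.restrict_le_self)
  · rw [← restrict_withDensity hK, ← Measure.restrict_add]
    conv_lhs => rw [← Measure.singularPart_add_rnDeriv μ ν]

theorem eventually_closedBall_subset {x x₀ : E n} {r : ℝ} (hx : x ∈ ball x₀ r) :
    ∀ᶠ s in 𝓝[>] (0 : ℝ), closedBall x s ⊆ closedBall x₀ r := by
  have : dist x x₀ < r := hx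
  filter_upwards [mem_nhdsWithin_of_mem_nhds (Iio_mem_nhds (sub_pos.2 this))] with s hs
  exact closedBall_subset_closedBall' (by have : s < r - dist x x₀ := hs; linarith)

/-- The Besicovitch differentiation theorem for Radon measures on an open set, which need not be
locally finite on the boundary of that set. -/
theorem IsRadonOn.ae_tendsto_rnDeriv (hΩ : IsOpen Ω) (hμ : IsRadonOn Ω μ) (hν : IsRadonOn Ω ν) :
    ∀ᵐ x ∂ν, Tendsto (fun r => μ (closedBall x r) / ν (closedBall x r)) (𝓝[>] 0)
      (𝓝 (μ.rnDeriv ν x)) := by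
  have := hμ.sigmaFinite hΩ
  have := hν.sigmaFinite hΩ
  refine ae_of_ae_restrict_closedBall hΩ hν.compl_null fun x₀ r _ hr => ?_
  have := hμ.isFiniteMeasure_restrict hr
  have := hν.isFiniteMeasure_restrict hr
  filter_upwards [Besicovitch.ae_tendsto_rnDeriv (μ.restrict (closedBall x₀ r))
    (ν.restrict (closedBall x₀ r)), rnDeriv_restrict_restrict μ ν
      (measurableSet_closedBall (x := x₀) (ε := r))] with x h1 h2 hx
  rw [h2] at h1
  refine h1.congr' ?_
  filter_upwards [eventually_closedBall_subset hx] with s hs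
  rw [Measure.restrict_eq_self _ hs, Measure.restrict_eq_self _ hs]

/-- Almost every point is a Lebesgue point of a bounded measurable function. -/
theorem IsRadonOn.ae_tendsto_average_abs_sub (hΩ : IsOpen Ω) (hν : IsRadonOn Ω ν) {τ : E n → ℝ}
    (hτ : Measurable τ) {C : ℝ} (hC : ∀ x, |τ x| ≤ C) :
    ∀ᵐ x ∂ν, Tendsto (fun r => (ν.real (closedBall x r))⁻¹ *
      ∫ y in closedBall x r, |τ y - τ x| ∂ν) (𝓝[>] 0) (𝓝 0) := by
  refine ae_of_ae_restrict_closedBall hΩ hν.compl_null fun x₀ r _ hr => ?_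
  have := hν.isFiniteMeasure_restrict hr
  have hint : Integrable τ (ν.restrict (closedBall x₀ r)) :=
    Integrable.of_bound hτ.aestronglyMeasurable C (ae_of_all _ hC)
  filter_upwards [(Besicovitch.vitaliFamily (ν.restrict (closedBall x₀ r))).ae_tendsto_average_norm_sub
    hint.locallyIntegrable] with x h1 hx
  refine (h1.comp (Besicovitch.tendsto_filterAt _ x)).congr' ?_
  filter_upwards [eventually_closedBall_subset hx] with s hs
  simp only [Function.comp, setAverage_eq, smul_eq_mul, Real.norm_eq_abs]
  rw [Measure.restrict_restrict_of_subset hs, measureReal_def, Measure.restrict_eq_self _ hs,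
    measureReal_def]

end Radon

/-! ### Mollification by radial kernels -/

section Mollify

variable {n : ℕ} {μ ν : Measure (E n)}

theorem integrable_of_bounded_of_support {X : Type*} [MeasurableSpace X] {μ : Measure X}
    {f : X → ℝ} {K : Set X} (hf : AEStronglyMeasurable f μ) {C : ℝ} (hC : ∀ y, |f y| ≤ C)
    (hK : ∀ y, y ∉ K → f y = 0) (hμ : μ K < ∞) : Integrable f μ := by
  refine (integrableOn_iff_integrable_of_support_subset (s := K) ?_).1 ?_
  · intro y hy
    by_contra h
    exact hy (hK y h)
  · exact Measure.integrableOn_of_bounded hμ.ne hf (ae_of_all _ hC)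

/-- Comparing two measures on small balls centered at `x` is enough to compare their integrals
of a radially decreasing function with small support: the superlevel sets of such a function are
balls. -/
theorem lintegral_radial_le_of_closedBall_le {x : E n} {G : ℝ → ℝ} {R r₀ : ℝ} (hR : R < r₀)
    (hG : ContinuousOn G (Ici 0)) (hanti : AntitoneOn G (Ici 0)) (hnn : ∀ t, 0 ≤ t → 0 ≤ G t)
    (hzero : ∀ t, R ≤ t → G t = 0)
    (h : ∀ r, 0 < r → r < r₀ → μ (closedBall x r) ≤ ν (closedBall x r)) :
    ∫⁻ y, ENNReal.ofReal (G ‖y - x‖) ∂μ ≤ ∫⁻ y, ENNReal.ofReal (G ‖y - x‖) ∂ν := by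
  have hcont : Continuous fun y : E n => G ‖y - x‖ :=
    hG.comp_continuous (by fun_prop) fun y => norm_nonneg _
  have hn (m : Measure (E n)) : 0 ≤ᵐ[m] fun y : E n => G ‖y - x‖ :=
    ae_of_all _ fun y => hnn _ (norm_nonneg _)
  rw [lintegral_eq_lintegral_meas_lt μ (hn μ) hcont.aemeasurable,
    lintegral_eq_lintegral_meas_lt ν (hn ν) hcont.aemeasurable]
  refine setLIntegral_mono' measurableSet_Ioi fun t ht => ?_
  have ht0 : 0 < t := ht
  -- the superlevel set is an increasing union of closed balls of rational radius
  have hU : {y : E n | t < G ‖y - x‖} =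
      ⋃ s : {s : ℚ // 0 < s ∧ t < G s}, closedBall x ((s : ℚ) : ℝ) := by
    ext y
    simp only [mem_ofPred_eq, mem_iUnion, mem_closedBall, dist_eq_norm]
    constructor
    · intro hy
      have hev : ∀ᶠ s in 𝓝[≥] ‖y - x‖, t < G s :=
        ((hG ‖y - x‖ (norm_nonneg _)).mono
          (Ici_subset_Ici.2 (norm_nonneg _))).eventually (lt_mem_nhds hy)
      obtain ⟨u, hu, hus⟩ := (mem_nhdsGE_iff_exists_Ico_subset).1 hev
      obtain ⟨q, hq1, hq2⟩ := exists_rat_btwn (mem_Ioi.1 hu)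
      refine ⟨⟨q, ?_, hus ⟨hq1.le, hq2⟩⟩, hq1.le⟩
      exact_mod_cast (norm_nonneg _).trans_lt hq1
    · rintro ⟨⟨s, hs0, hs⟩, hy⟩
      exact hs.trans_le (hanti (norm_nonneg _) (by exact_mod_cast hs0.le : (0 : ℝ) ≤ s) hy)
  have hdir : Directed (· ⊆ ·)
      fun s : {s : ℚ // 0 < s ∧ t < G s} => closedBall x ((s : ℚ) : ℝ) :=
    Monotone.directed_le fun a b hab => closedBall_subset_closedBall (by exact_mod_cast hab)
  rw [hU, hdir.measure_iUnion]
  refine iSup_le fun s => (h _ (by exact_mod_cast s.2.1) ?_).trans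
    (measure_mono (subset_iUnion (fun s : {s : ℚ // 0 < s ∧ t < G s} =>
      closedBall x ((s : ℚ) : ℝ)) s))
  by_contra hcon
  have := hzero (s : ℚ) (hR.le.trans (not_lt.1 hcon))
  linarith [s.2.2]

/-- A radial profile: continuous and nonnegative on `[0, ∞)` and vanishing on `[1, ∞)`. As for
the kernels of the statement, its values on the negative half-line are irrelevant. -/
structure IsProfile (κ : ℝ → ℝ) : Prop where
  continuousOn : ContinuousOn κ (Ici 0)
  nonneg : ∀ t, 0 ≤ t → 0 ≤ κ t
  zero : ∀ t, 1 ≤ t → κ t = 0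

theorem IsProfile.continuous_norm {κ : ℝ → ℝ} (hκ : IsProfile κ) :
    Continuous fun z : E n => κ ‖z‖ :=
  hκ.continuousOn.comp_continuous _root_.continuous_norm fun _ => norm_nonneg _

theorem IsProfile.continuous_scaledKernel {κ : ℝ → ℝ} (hκ : IsProfile κ) {ε : ℝ} (hε : 0 < ε) :
    Continuous (scaledKernel (n := n) κ ε) := by
  unfold scaledKernel
  exact continuous_const.mul (hκ.continuousOn.comp_continuous (by fun_prop)
    fun z => div_nonneg (norm_nonneg _) hε.le)

theorem IsProfile.scaledKernel_nonneg {κ : ℝ → ℝ} (hκ : IsProfile κ) {ε : ℝ} (hε : 0 < ε)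
    (z : E n) : 0 ≤ scaledKernel κ ε z :=
  mul_nonneg (by positivity) (hκ.nonneg _ (by positivity))

theorem IsProfile.scaledKernel_eq_zero {κ : ℝ → ℝ} (hκ : IsProfile κ) {ε : ℝ} (hε : 0 < ε)
    {z : E n} (hz : ε ≤ ‖z‖) : scaledKernel κ ε z = 0 := by
  rw [scaledKernel, hκ.zero _ ((one_le_div hε).2 hz), mul_zero]

theorem IsProfile.exists_le {κ : ℝ → ℝ} (hκ : IsProfile κ) :
    ∃ C, 0 ≤ C ∧ ∀ t, 0 ≤ t → κ t ≤ C := by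
  obtain ⟨C, hC⟩ := isCompact_Icc.exists_bound_of_continuousOn
    (hκ.continuousOn.mono (Icc_subset_Ici_self : Icc (0 : ℝ) 1 ⊆ Ici 0))
  have hC0 : 0 ≤ C := (norm_nonneg _).trans (hC 0 (by simp))
  refine ⟨C, hC0, fun t ht => ?_⟩
  rcases le_total t 1 with h1 | h1
  · exact (le_abs_self _).trans (hC t ⟨ht, h1⟩)
  · rw [hκ.zero t h1]
    exact hC0

theorem scaledKernel_sub_comm (κ : ℝ → ℝ) (ε : ℝ) (x y : E n) :
    scaledKernel κ ε (x - y) = scaledKernel κ ε (y - x) := by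
  rw [scaledKernel, scaledKernel, norm_sub_rev]

theorem IsProfile.integrable_scaledKernel_mul {κ : ℝ → ℝ} (hκ : IsProfile κ) {ε : ℝ} (hε : 0 < ε)
    {x : E n} (hμ : μ (closedBall x ε) < ∞) {τ : E n → ℝ} (hτ : AEStronglyMeasurable τ μ) {C : ℝ}
    (hC : ∀ y, |τ y| ≤ C) : Integrable (fun y => scaledKernel κ ε (x - y) * τ y) μ := by
  obtain ⟨D, hD0, hD⟩ := hκ.exists_le
  refine integrable_of_bounded_of_support (K := closedBall x ε) (C := (ε ^ n)⁻¹ * D * C)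
    (((hκ.continuous_scaledKernel hε).comp
      (by fun_prop : Continuous fun y => x - y)).aestronglyMeasurable.mul hτ) ?_ ?_ hμ
  · intro y
    rw [abs_mul, abs_of_nonneg (hκ.scaledKernel_nonneg hε _)]
    refine mul_le_mul ?_ (hC y) (abs_nonneg _) (by positivity)
    exact mul_le_mul_of_nonneg_left (hD _ (by positivity)) (by positivity)
  · intro y hy
    rw [mem_closedBall', dist_eq_norm, not_le] at hy
    rw [hκ.scaledKernel_eq_zero hε hy.le, zero_mul]

theorem IsProfile.integrable_scaledKernel {κ : ℝ → ℝ} (hκ : IsProfile κ) {ε : ℝ} (hε : 0 < ε)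
    {x : E n} (hμ : μ (closedBall x ε) < ∞) : Integrable (fun y => scaledKernel κ ε (x - y)) μ := by
  simpa using hκ.integrable_scaledKernel_mul hε hμ (τ := fun _ => (1 : ℝ)) (by fun_prop) (C := 1)
    (by simp)

/-- Where the ratio of the measures of small balls converges, so does the ratio of the
mollifications by a radially decreasing kernel. -/
theorem IsProfile.tendsto_convolve_div_convolve {κ : ℝ → ℝ} (hκ : IsProfile κ)
    (hanti : AntitoneOn κ (Ici 0)) {x : E n} {f : ℝ≥0∞} (hf : f ≠ ∞) {R : ℝ} (hR : 0 < R)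
    (hμ : μ (closedBall x R) < ∞) (hν : ν (closedBall x R) < ∞)
    (hlim : Tendsto (fun r => μ (closedBall x r) / ν (closedBall x r)) (𝓝[>] 0) (𝓝 f))
    (hpos : ∀ᶠ ε in 𝓝[>] (0 : ℝ), 0 < convolve ν (scaledKernel κ ε) x) :
    Tendsto (fun ε => convolve μ (scaledKernel κ ε) x / convolve ν (scaledKernel κ ε) x)
      (𝓝[>] 0) (𝓝 f.toReal) := by
  rw [Metric.tendsto_nhds]
  intro δ hδ
  have hδ2 : 0 < δ / 2 := by positivity
  have hev := (ENNReal.tendsto_nhds hf).1 hlim (ENNReal.ofReal (δ / 2)) (by simpa using hδ)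
  obtain ⟨r₁, hr₁, hsub⟩ := mem_nhdsGT_iff_exists_Ioo_subset.1 hev
  have hr₁ : 0 < r₁ := hr₁
  have hmin : 0 < min r₁ R := lt_min hr₁ hR
  have hfin {m : Measure (E n)} (hm : m (closedBall x R) < ∞) {s : ℝ} (hs : s < min r₁ R) :
      m (closedBall x s) < ∞ :=
    (measure_mono (closedBall_subset_closedBall (hs.le.trans (min_le_right _ _)))).trans_lt hm
  filter_upwards [hpos, Ioo_mem_nhdsGT hmin] with ε hεpos hε
  have hε0 : 0 < ε := hε.1
  set G : ℝ → ℝ := fun t => (ε ^ n)⁻¹ * κ (t / ε) with hGdef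
  have hmaps : MapsTo (fun t : ℝ => t / ε) (Ici 0) (Ici 0) := fun t ht => div_nonneg ht hε0.le
  have hGc : ContinuousOn G (Ici 0) :=
    continuousOn_const.mul (hκ.continuousOn.comp (by fun_prop) hmaps)
  have hGa : AntitoneOn G (Ici 0) := fun a ha b hb hab =>
    mul_le_mul_of_nonneg_left (hanti (hmaps ha) (hmaps hb)
      (div_le_div_of_nonneg_right hab hε0.le)) (by positivity)
  have hGn : ∀ t, 0 ≤ t → 0 ≤ G t := fun t ht =>
    mul_nonneg (by positivity) (hκ.nonneg _ (hmaps ht))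
  have hGz : ∀ t, ε ≤ t → G t = 0 := fun t ht => by
    simp only [hGdef]
    rw [hκ.zero _ ((one_le_div hε0).2 ht), mul_zero]
  have hconv {m : Measure (E n)} (hm : m (closedBall x R) < ∞) :
      ENNReal.ofReal (convolve m (scaledKernel κ ε) x) = ∫⁻ y, ENNReal.ofReal (G ‖y - x‖) ∂m := by
    rw [convolve, ofReal_integral_eq_lintegral_ofReal
      (hκ.integrable_scaledKernel hε0 (hfin hm hε.2))
      (ae_of_all _ fun y => hκ.scaledKernel_nonneg hε0 _)]
    refine lintegral_congr fun y => ?_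
    rw [scaledKernel_sub_comm, scaledKernel]
  have hup : ∫⁻ y, ENNReal.ofReal (G ‖y - x‖) ∂μ ≤
      (f + ENNReal.ofReal (δ / 2)) * ∫⁻ y, ENNReal.ofReal (G ‖y - x‖) ∂ν := by
    rw [← smul_eq_mul, ← lintegral_smul_measure]
    refine lintegral_radial_le_of_closedBall_le hε.2 hGc hGa hGn hGz fun r hr0 hr => ?_
    have h1 : μ (closedBall x r) / ν (closedBall x r) ≤ f + ENNReal.ofReal (δ / 2) :=
      (hsub ⟨hr0, hr.trans_le (min_le_left _ _)⟩).2
    rw [Measure.smul_apply, smul_eq_mul]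
    rwa [ENNReal.div_le_iff_le_mul (Or.inr (ENNReal.add_ne_top.2 ⟨hf, ENNReal.ofReal_ne_top⟩))
      (Or.inl (hfin hν hr).ne)] at h1
  have hlow : (f - ENNReal.ofReal (δ / 2)) * ∫⁻ y, ENNReal.ofReal (G ‖y - x‖) ∂ν ≤
      ∫⁻ y, ENNReal.ofReal (G ‖y - x‖) ∂μ := by
    rw [← smul_eq_mul, ← lintegral_smul_measure]
    refine lintegral_radial_le_of_closedBall_le hε.2 hGc hGa hGn hGz fun r hr0 hr => ?_
    have h1 : f - ENNReal.ofReal (δ / 2) ≤ μ (closedBall x r) / ν (closedBall x r) :=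
      (hsub ⟨hr0, hr.trans_le (min_le_left _ _)⟩).1
    rw [Measure.smul_apply, smul_eq_mul]
    exact ENNReal.mul_le_of_le_div h1
  have hnn (m : Measure (E n)) : 0 ≤ convolve m (scaledKernel κ ε) x :=
    integral_nonneg fun y => hκ.scaledKernel_nonneg hε0 _
  rw [← hconv hμ, ← hconv hν] at hup hlow
  obtain ⟨f', rfl⟩ : ∃ f' : ℝ≥0, f = f' := ⟨f.toNNReal, (ENNReal.coe_toNNReal hf).symm⟩
  set a := convolve μ (scaledKernel κ ε) x
  set b := convolve ν (scaledKernel κ ε) x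
  have hup' : a ≤ (f' + δ / 2) * b := by
    rw [← ENNReal.ofReal_coe_nnreal, ← ENNReal.ofReal_add (by positivity) hδ2.le,
      ← ENNReal.ofReal_mul (by positivity)] at hup
    exact (ENNReal.ofReal_le_ofReal_iff (by positivity)).1 hup
  have hlow' : (f' - δ / 2) * b ≤ a := by
    rw [← ENNReal.ofReal_coe_nnreal, ← ENNReal.ofReal_sub _ hδ2.le,
      ← ENNReal.ofReal_mul' hεpos.le] at hlow
    exact (ENNReal.ofReal_le_ofReal_iff (hnn μ)).1 hlow
  rw [Real.dist_eq, ENNReal.coe_toReal, abs_lt]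
  have h1 : a / b ≤ f' + δ / 2 := (div_le_iff₀ hεpos).2 hup'
  have h2 : f' - δ / 2 ≤ a / b := (le_div_iff₀ hεpos).2 hlow'
  constructor <;> linarith

/-- A bounded function averaged against a kernel concentrating at a Lebesgue point converges to its
value there, provided that the kernel averages are comparable with averages over balls. -/
theorem IsProfile.tendsto_convolve_mul_div {κ : ℝ → ℝ} (hκ : IsProfile κ) {x : E n} {R : ℝ}
    (hR : 0 < R) (hν : ν (closedBall x R) < ∞) {τ : E n → ℝ} (hτ : Measurable τ) {C : ℝ}
    (hC : ∀ x, |τ x| ≤ C)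
    (hleb : Tendsto (fun r => (ν.real (closedBall x r))⁻¹ *
      ∫ y in closedBall x r, |τ y - τ x| ∂ν) (𝓝[>] 0) (𝓝 0)) {D : ℝ}
    (hD : ∀ᶠ ε in 𝓝[>] (0 : ℝ), 0 < convolve ν (scaledKernel κ ε) x ∧
      (ε ^ n)⁻¹ * ν.real (closedBall x ε) ≤ D * convolve ν (scaledKernel κ ε) x) :
    Tendsto (fun ε => (∫ y, scaledKernel κ ε (x - y) * τ y ∂ν) /
      convolve ν (scaledKernel κ ε) x) (𝓝[>] 0) (𝓝 (τ x)) := by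
  obtain ⟨S, hS0, hS⟩ := hκ.exists_le
  rw [tendsto_iff_norm_sub_tendsto_zero]
  have hlim := (hleb.const_mul (S * D))
  rw [mul_zero] at hlim
  refine squeeze_zero' (Eventually.of_forall fun _ => norm_nonneg _) ?_ hlim
  filter_upwards [hD, Ioo_mem_nhdsGT hR] with ε hεD hε
  obtain ⟨hpos, hle⟩ := hεD
  have hε0 : 0 < ε := hε.1
  have hfin : ν (closedBall x ε) < ∞ :=
    (measure_mono (closedBall_subset_closedBall hε.2.le)).trans_lt hν
  have hi1 := hκ.integrable_scaledKernel_mul hε0 hfin hτ.aestronglyMeasurable hC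
  have hi0 := hκ.integrable_scaledKernel hε0 hfin
  have hτ' : Measurable fun y => |τ y - τ x| := (hτ.sub_const _).abs
  have hC' (y : E n) : |(|τ y - τ x|)| ≤ C + C := by
    rw [abs_abs]; exact (abs_sub _ _).trans (add_le_add (hC _) (hC _))
  have hi2 := hκ.integrable_scaledKernel_mul hε0 hfin hτ'.aestronglyMeasurable hC'
  set b := convolve ν (scaledKernel κ ε) x with hb
  set I := ∫ y in closedBall x ε, |τ y - τ x| ∂ν with hI
  have hI0 : 0 ≤ I := integral_nonneg fun _ => abs_nonneg _
  have hnum : ‖(∫ y, scaledKernel κ ε (x - y) * τ y ∂ν) / b - τ x‖ ≤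
      (∫ y, scaledKernel κ ε (x - y) * |τ y - τ x| ∂ν) / b := by
    have h1 : (∫ y, scaledKernel κ ε (x - y) * τ y ∂ν) / b - τ x =
        (∫ y, scaledKernel κ ε (x - y) * (τ y - τ x) ∂ν) / b := by
      have : ∫ y, scaledKernel κ ε (x - y) * (τ y - τ x) ∂ν =
          (∫ y, scaledKernel κ ε (x - y) * τ y ∂ν) - b * τ x := by
        rw [hb, convolve, ← integral_mul_const, ← integral_sub hi1 (hi0.mul_const _)]
        simp only [mul_sub]
      rw [this, sub_div, mul_div_cancel_left₀ _ hpos.ne']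
    rw [h1, norm_div, Real.norm_of_nonneg hpos.le]
    gcongr
    refine (norm_integral_le_integral_norm _).trans (le_of_eq ?_)
    congr 1 with y
    rw [norm_mul, Real.norm_of_nonneg (hκ.scaledKernel_nonneg hε0 _), Real.norm_eq_abs]
  have hker : ∫ y, scaledKernel κ ε (x - y) * |τ y - τ x| ∂ν ≤ (ε ^ n)⁻¹ * S * I := by
    rw [← setIntegral_eq_integral_of_forall_compl_eq_zero (s := closedBall x ε), hI,
      ← integral_const_mul]
    · refine setIntegral_mono hi2.integrableOn ?_ fun y => ?_
      · refine Integrable.const_mul ?_ _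
        exact Measure.integrableOn_of_bounded hfin.ne hτ'.aestronglyMeasurable (ae_of_all _ hC')
      · refine mul_le_mul_of_nonneg_right ?_ (abs_nonneg _)
        exact mul_le_mul_of_nonneg_left (hS _ (by positivity)) (by positivity)
    · intro y hy
      rw [mem_closedBall', dist_eq_norm, not_le] at hy
      rw [hκ.scaledKernel_eq_zero hε0 hy.le, zero_mul]
  refine hnum.trans ?_
  rw [div_le_iff₀ hpos]
  rcases (measureReal_nonneg (μ := ν) (s := closedBall x ε)).eq_or_lt with h0 | h0
  · have : I = 0 := by
      rw [hI, Measure.restrict_eq_zero.2 ((measureReal_eq_zero_iff hfin.ne).1 h0.symm),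
        integral_zero_measure]
    rw [this] at hker ⊢
    simpa using hker
  · refine hker.trans ?_
    calc (ε ^ n)⁻¹ * S * I
        = S * ((ν.real (closedBall x ε))⁻¹ * I) * ((ε ^ n)⁻¹ * ν.real (closedBall x ε)) := by
          field_simp
      _ ≤ S * ((ν.real (closedBall x ε))⁻¹ * I) * (D * b) := by gcongr
      _ = _ := by ring

end Mollify

/-! ### Radial kernels on space and on planes -/

section Kernels

variable {n d : ℕ}

/-- A radial function is of class `C¹` as soon as its profile is, with zero slope at the origin. -/
theorem contDiff_comp_norm {ρ : ℝ → ℝ} (hρ : ContDiffOn ℝ 1 ρ (Ici 0))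
    (h0 : derivWithin ρ (Ici 0) 0 = 0) : ContDiff ℝ 1 fun x : E n => ρ ‖x‖ := by
  have hdc : ContinuousOn (derivWithin ρ (Ici 0)) (Ici 0) :=
    hρ.continuousOn_derivWithin (uniqueDiffOn_Ici 0) le_rfl
  have hda (t : ℝ) (ht : 0 ≤ t) : HasDerivWithinAt ρ (derivWithin ρ (Ici 0) t) (Ici 0) t :=
    ((hρ.differentiableOn one_ne_zero) t ht).hasDerivWithinAt
  have hdn : Continuous fun x : E n => derivWithin ρ (Ici 0) ‖x‖ :=
    hdc.comp_continuous continuous_norm fun _ => norm_nonneg _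
  refine contDiff_one_iff_hasFDerivAt.2
    ⟨fun x => derivWithin ρ (Ici 0) ‖x‖ • fderiv ℝ (fun y : E n => ‖y‖) x, ?_, fun x => ?_⟩
  · refine continuous_iff_continuousAt.2 fun x => ?_
    by_cases hx : x = 0
    · subst hx
      -- the derivative of the norm is bounded and the slope of the profile tends to zero
      have hlim : Tendsto (fun x : E n => |derivWithin ρ (Ici 0) ‖x‖|) (𝓝 0) (𝓝 0) := by
        have := hdn.abs.tendsto 0
        simpa [h0] using this
      rw [ContinuousAt, norm_zero, h0, zero_smul]
      refine squeeze_zero_norm (fun x => ?_) hlim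
      rw [norm_smul, Real.norm_eq_abs]
      refine mul_le_of_le_one_right (abs_nonneg _) ?_
      simpa using norm_fderiv_le_of_lipschitz ℝ (x₀ := x) (lipschitzWith_one_norm (E := E n))
    · exact hdn.continuousAt.smul ((contDiffAt_norm ℝ hx (n := 1)).continuousAt_fderiv one_ne_zero)
  · by_cases hx : x = 0
    · subst hx
      beta_reduce
      rw [norm_zero, h0, zero_smul, hasFDerivAt_iff_isLittleO_nhds_zero]
      have h1 := hda 0 le_rfl
      rw [h0, hasDerivWithinAt_iff_isLittleO] at h1
      have h2 : Tendsto (fun h : E n => ‖h‖) (𝓝 0) (𝓝[Ici 0] 0) :=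
        tendsto_nhdsWithin_iff.2 ⟨by simpa using (continuous_norm (E := E n)).tendsto 0,
          Eventually.of_forall fun h => norm_nonneg h⟩
      have h3 := h1.comp_tendsto h2
      exact Asymptotics.IsLittleO.of_norm_right (by simpa [Function.comp_def] using h3)
    · have hn := (contDiffAt_norm ℝ hx (n := 1)).differentiableAt one_ne_zero
      exact (hda ‖x‖ (norm_nonneg x)).comp_hasFDerivAt x hn.hasFDerivAt
        (Eventually.of_forall fun y => norm_nonneg y)

theorem scaledKernel_eq_smul (κ : ℝ → ℝ) {ε : ℝ} (hε : 0 < ε) (z : E n) :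
    scaledKernel κ ε z = (ε ^ n)⁻¹ * κ ‖ε⁻¹ • z‖ := by
  rw [scaledKernel, norm_smul, Real.norm_of_nonneg (by positivity), div_eq_inv_mul]

theorem contDiff_scaledKernel {ρ : ℝ → ℝ} (hρ : ContDiffOn ℝ 1 ρ (Ici 0))
    (h0 : derivWithin ρ (Ici 0) 0 = 0) {ε : ℝ} (hε : 0 < ε) :
    ContDiff ℝ 1 (scaledKernel (n := n) ρ ε) := by
  have : scaledKernel (n := n) ρ ε = fun z => (ε ^ n)⁻¹ * ρ ‖ε⁻¹ • z‖ :=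
    funext (scaledKernel_eq_smul ρ hε)
  rw [this]
  exact contDiff_const.mul ((contDiff_comp_norm hρ h0).comp (contDiff_const_smul _))

/-- A radial function has the same integral over every `d`-plane through the origin. -/
theorem IsProfile.integral_plane {κ : ℝ → ℝ} (hκ : IsProfile κ) (hd : 1 ≤ d)
    (S : Grassmannian d n) :
    ∫ y in plane S, κ ‖y‖ ∂(Measure.euclideanHausdorffMeasure d) = kernelConstant d κ := by
  have : NeZero d := ⟨by omega⟩
  let p : Submodule ℝ (E n) := LinearMap.range S.1.toLinearMap
  have hp : Module.finrank ℝ p = d := S.2.2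
  let b : OrthonormalBasis (Fin d) ℝ p := (stdOrthonormalBasis ℝ p).reindex (finCongr hp)
  let L : E d →ₗᵢ[ℝ] E n := p.subtypeₗᵢ.comp b.repr.symm.toLinearIsometry
  have hL : range L = plane S := by
    ext y
    constructor
    · rintro ⟨z, rfl⟩
      exact (b.repr.symm z).2
    · rintro ⟨z, rfl⟩
      refine ⟨b.repr ⟨S.1 z, ⟨z, rfl⟩⟩, ?_⟩
      simp [L]
  rw [← hL, ← L.isometry.map_euclideanHausdorffMeasure,
    L.isometry.isClosedEmbedding.measurableEmbedding.integral_map,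
    EuclideanSpace.euclideanHausdorffMeasure_eq_volume]
  simp only [L.norm_map]
  rw [integral_fun_norm_addHaar, kernelConstant, unitBallVolume, finrank_euclideanSpace_fin,
    nsmul_eq_mul, smul_eq_mul, measureReal_def, mul_assoc, intervalIntegral.integral_of_le zero_le_one]
  congr 2
  rw [← setIntegral_eq_of_subset_of_forall_sdiff_eq_zero measurableSet_Ioi
    (Ioc_subset_Ioi_self : Ioc (0 : ℝ) 1 ⊆ Ioi 0)]
  · simp only [smul_eq_mul, mul_comm]
  · rintro r ⟨hr, hr1⟩
    rw [hκ.zero r, zero_mul]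
    by_contra h
    exact hr1 ⟨hr, (not_le.1 h).le⟩

theorem kernelConstant_pos {κ : ℝ → ℝ} (hκ : IsProfile κ) (hd : 1 ≤ d)
    (h : ∃ t, 0 ≤ t ∧ κ t ≠ 0) : 0 < kernelConstant d κ := by
  have hd' : 0 < d := hd
  have hball : 0 < unitBallVolume d :=
    ENNReal.toReal_pos (measure_ball_pos _ _ one_pos).ne' measure_ball_lt_top.ne
  obtain ⟨t, ht, hκt⟩ := h
  have ht1 : t < 1 := by
    by_contra hcon
    exact hκt (hκ.zero t (not_lt.1 hcon))
  have hpos : 0 < κ t := lt_of_le_of_ne (hκ.nonneg t ht) (Ne.symm hκt)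
  have hev : ∀ᶠ s in 𝓝[>] t, 0 < κ s :=
    ((hκ.continuousOn t ht).mono (Ioi_subset_Ici ht)).eventually (lt_mem_nhds hpos)
  obtain ⟨s, hs, hst⟩ := (hev.and (Ioo_mem_nhdsGT ht1)).exists
  have hs0 : 0 < s := ht.trans_lt hst.1
  refine mul_pos (mul_pos (by exact_mod_cast hd') hball) ?_
  refine intervalIntegral.integral_pos zero_lt_one ?_ ?_ ⟨s, ⟨hs0.le, hst.2.le⟩, ?_⟩
  · exact (hκ.continuousOn.mono Icc_subset_Ici_self).mul (by fun_prop)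
  · intro r hr
    exact mul_nonneg (hκ.nonneg r hr.1.le) (pow_nonneg hr.1.le _)
  · exact mul_pos hs (pow_pos hs0 _)

theorem IsKernelTriple.isProfile_rho {ρ ξ η : ℝ → ℝ} (h : IsKernelTriple n ρ ξ η) : IsProfile ρ :=
  ⟨h.rho_contDiff.continuousOn, h.rho_nonneg, h.rho_zero⟩

theorem IsKernelTriple.isProfile_xi {ρ ξ η : ℝ → ℝ} (h : IsKernelTriple n ρ ξ η) : IsProfile ξ :=
  ⟨h.xi_contDiff.continuousOn, h.xi_nonneg, h.xi_zero⟩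

theorem IsKernelTriple.isProfile_eta {ρ ξ η : ℝ → ℝ} (h : IsKernelTriple n ρ ξ η) : IsProfile η :=
  ⟨h.eta_contDiff.continuousOn, h.eta_nonneg, h.eta_zero⟩

theorem IsKernelTriple.rho_nontrivial {ρ ξ η : ℝ → ℝ} (h : IsKernelTriple n ρ ξ η) :
    ∃ t, 0 ≤ t ∧ ρ t ≠ 0 := by
  by_contra! hcon
  have := h.rho_integral
  simp [hcon _ (norm_nonneg _)] at this

theorem IsKernelTriple.xi_nontrivial {ρ ξ η : ℝ → ℝ} (h : IsKernelTriple n ρ ξ η) :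
    ∃ t, 0 ≤ t ∧ ξ t ≠ 0 :=
  ⟨1 / 2, by norm_num, (h.xi_pos _ (by norm_num) (by norm_num)).ne'⟩

end Kernels

/-! ### The mass near a point with an approximate tangent space -/

section Tangent

variable {n d : ℕ} {M : Set (E n)} {θ : E n → ℝ≥0} {x : E n} {S : Grassmannian d n}

theorem IsApproxTangentSpace.tendsto_convolve (hS : IsApproxTangentSpace M θ x S) (hd : 1 ≤ d)
    {κ : ℝ → ℝ} (hκ : IsProfile κ) :
    Tendsto (fun ε => (ε ^ d)⁻¹ * (ε ^ n * convolve (weightedHausdorff d M θ) (scaledKernel κ ε) x))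
      (𝓝[>] 0) (𝓝 (θ x * kernelConstant d κ)) := by
  have hsupp : HasCompactSupport fun z : E n => κ ‖z‖ := by
    refine HasCompactSupport.intro (isCompact_closedBall (0 : E n) 1) fun z hz => hκ.zero _ ?_
    rw [mem_closedBall_zero_iff, not_le] at hz
    exact hz.le
  have h := hS _ hκ.continuous_norm hsupp
  rw [hκ.integral_plane hd] at h
  refine h.congr' ?_
  filter_upwards [self_mem_nhdsWithin] with ε hε
  have hε : 0 < ε := hε
  congr 1
  rw [convolve, ← integral_const_mul]
  congr 1 with y
  rw [scaledKernel_sub_comm, scaledKernel_eq_smul κ hε, mul_inv_cancel_left₀ (by positivity)]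

theorem IsApproxTangentSpace.eventually_convolve_pos (hS : IsApproxTangentSpace M θ x S)
    (hd : 1 ≤ d) (hθ : 0 < θ x) {κ : ℝ → ℝ} (hκ : IsProfile κ) (hne : ∃ t, 0 ≤ t ∧ κ t ≠ 0) :
    ∀ᶠ ε in 𝓝[>] (0 : ℝ), 0 < convolve (weightedHausdorff d M θ) (scaledKernel κ ε) x := by
  have hpos : (0 : ℝ) < θ x * kernelConstant d κ :=
    mul_pos (by exact_mod_cast hθ) (kernelConstant_pos hκ hd hne)
  filter_upwards [(hS.tendsto_convolve hd hκ).eventually (lt_mem_nhds hpos),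
    self_mem_nhdsWithin] with ε h hε
  have hε : 0 < ε := hε
  rw [mul_pos_iff_of_pos_left (by positivity), mul_pos_iff_of_pos_left (by positivity)] at h
  exact h

/-- Mollifications of the mass by two kernels are asymptotically proportional. -/
theorem IsApproxTangentSpace.tendsto_convolve_div (hS : IsApproxTangentSpace M θ x S)
    (hd : 1 ≤ d) (hθ : 0 < θ x) {κ₁ κ₂ : ℝ → ℝ} (hκ₁ : IsProfile κ₁) (hκ₂ : IsProfile κ₂)
    (hne : ∃ t, 0 ≤ t ∧ κ₂ t ≠ 0) :
    Tendsto (fun ε => convolve (weightedHausdorff d M θ) (scaledKernel κ₁ ε) x /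
      convolve (weightedHausdorff d M θ) (scaledKernel κ₂ ε) x)
      (𝓝[>] 0) (𝓝 (kernelConstant d κ₁ / kernelConstant d κ₂)) := by
  have hθ' : (0 : ℝ) < θ x := by exact_mod_cast hθ
  have hpos := mul_pos hθ' (kernelConstant_pos hκ₂ hd hne)
  have h := (hS.tendsto_convolve hd hκ₁).div (hS.tendsto_convolve hd hκ₂) hpos.ne'
  rw [mul_div_mul_left _ _ hθ'.ne'] at h
  refine h.congr' ?_
  filter_upwards [self_mem_nhdsWithin] with ε hε
  have hε : 0 < ε := hε
  simp only [Pi.div_apply]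
  rw [mul_div_mul_left _ _ (by positivity), mul_div_mul_left _ _ (by positivity)]

/-- The mass of small balls is controlled by any nontrivial mollification of the mass. -/
theorem IsApproxTangentSpace.exists_closedBall_le (hS : IsApproxTangentSpace M θ x S)
    (hd : 1 ≤ d) (hθ : 0 < θ x) {κ : ℝ → ℝ} (hκ : IsProfile κ) (hne : ∃ t, 0 ≤ t ∧ κ t ≠ 0) {R : ℝ}
    (hR : 0 < R) (hfin : weightedHausdorff d M θ (closedBall x R) < ∞) :
    ∃ D : ℝ, ∀ᶠ ε in 𝓝[>] (0 : ℝ), (ε ^ n)⁻¹ * (weightedHausdorff d M θ).real (closedBall x ε) ≤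
      D * convolve (weightedHausdorff d M θ) (scaledKernel κ ε) x := by
  set ν := weightedHausdorff d M θ with hν
  -- a compactly supported function that dominates the indicator of the unit ball
  set φ : E n → ℝ := fun z => max 0 (2 - ‖z‖) with hφ
  have hφc : Continuous φ := by fun_prop
  have hφ0 (z : E n) : 0 ≤ φ z := le_max_left _ _
  have hφ2 (z : E n) : |φ z| ≤ 2 := by
    rw [abs_of_nonneg (hφ0 z)]
    exact max_le (by norm_num) (by linarith [norm_nonneg z])
  have hφz (z : E n) (hz : 2 < ‖z‖) : φ z = 0 := max_eq_left (by linarith)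
  have hφs : HasCompactSupport φ := by
    refine HasCompactSupport.intro (isCompact_closedBall (0 : E n) 2) fun z hz => hφz z ?_
    simpa using hz
  set c : ℝ := θ x * kernelConstant d κ with hc
  have hpos : 0 < c := mul_pos (by exact_mod_cast hθ) (kernelConstant_pos hκ hd hne)
  have h1 := hS φ hφc hφs
  set l := (θ x : ℝ) * ∫ y in plane S, φ y ∂(Measure.euclideanHausdorffMeasure d) with hl
  have hl0 : 0 ≤ l := mul_nonneg (NNReal.coe_nonneg _) (integral_nonneg hφ0)
  refine ⟨(l + 1) * (2 / c), ?_⟩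
  filter_upwards [h1.eventually (gt_mem_nhds (lt_add_one l)),
    (hS.tendsto_convolve hd hκ).eventually (lt_mem_nhds (half_lt_self hpos)),
    Ioo_mem_nhdsGT (half_pos hR)] with ε hε1 hε2 hε
  have hε0 : 0 < ε := hε.1
  have hεR : ε * 2 ≤ R := by linarith [hε.2]
  have hint : Integrable (fun y => φ (ε⁻¹ • (y - x))) ν := by
    refine integrable_of_bounded_of_support (K := closedBall x R)
      (by fun_prop : Continuous fun y => φ (ε⁻¹ • (y - x))).aestronglyMeasurable
      (fun y => hφ2 _) (fun y hy => hφz _ ?_) hfin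
    rw [mem_closedBall, dist_eq_norm, not_le] at hy
    rw [norm_smul, Real.norm_of_nonneg (by positivity), ← div_eq_inv_mul, lt_div_iff₀ hε0]
    linarith
  have hball : ν.real (closedBall x ε) ≤ ∫ y, φ (ε⁻¹ • (y - x)) ∂ν := by
    have hlt : ν (closedBall x ε) < ∞ :=
      (measure_mono (closedBall_subset_closedBall (by linarith))).trans_lt hfin
    rw [← integral_indicator_one measurableSet_closedBall]
    refine integral_mono (IntegrableOn.integrable_indicator (integrableOn_const hlt.ne)
      measurableSet_closedBall) hint fun y => ?_
    by_cases hy : y ∈ closedBall x ε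
    · rw [indicator_of_mem hy]
      refine le_max_of_le_right ?_
      rw [mem_closedBall, dist_eq_norm] at hy
      rw [norm_smul, Real.norm_of_nonneg (by positivity), ← div_eq_inv_mul, Pi.one_apply]
      have := (div_le_one hε0).2 hy
      linarith
    · rw [indicator_of_notMem hy]
      exact hφ0 _
  have h2 : ν.real (closedBall x ε) ≤ (l + 1) * ε ^ d := by
    refine hball.trans ?_
    rw [inv_mul_lt_iff₀ (by positivity)] at hε1
    linarith
  set b := convolve ν (scaledKernel κ ε) x
  have h3 : c / 2 * ε ^ d ≤ ε ^ n * b := by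
    rw [lt_inv_mul_iff₀ (by positivity)] at hε2
    linarith
  rw [inv_mul_le_iff₀ (by positivity)]
  calc ν.real (closedBall x ε) ≤ (l + 1) * ε ^ d := h2
    _ = (l + 1) * (2 / c) * (c / 2 * ε ^ d) := by field_simp
    _ ≤ (l + 1) * (2 / c) * (ε ^ n * b) := by gcongr
    _ = _ := by ring

end Tangent

/-! ### The linear system of the second fundamental form -/

section System

variable {n : ℕ}

/-- The matrix `c` has nonnegative quadratic form (it need not be symmetric). -/
def IsAccretive (c : Fin n → Fin n → ℝ) : Prop := ∀ v : Fin n → ℝ, 0 ≤ ∑ i, v i * ∑ k, c i k * v k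

/-- The partial trace `(∑_q a_{qiq})_i` of a tensor, as a vector of `ℝⁿ`. -/
def partialTrace (a : Fin n → Fin n → Fin n → ℝ) : E n := WithLp.toLp 2 fun i => ∑ q, a q i q

@[simp] theorem partialTrace_apply (a : Fin n → Fin n → Fin n → ℝ) (i : Fin n) :
    partialTrace a i = ∑ q, a q i q := rfl

theorem IsAccretive.norm_le {c : Fin n → Fin n → ℝ} (hc : IsAccretive c) {h w : E n}
    (heq : ∀ i, h i + ∑ k, c i k * h k = w i) : ‖h‖ ≤ ‖w‖ := by
  have h1 : ‖h‖ ^ 2 ≤ inner ℝ h w := by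
    have h2 : inner ℝ h w = (∑ i, h i ^ 2) + ∑ i, h i * ∑ k, c i k * h k := by
      rw [← Finset.sum_add_distrib, PiLp.inner_apply]
      refine Finset.sum_congr rfl fun i _ => ?_
      rw [← heq i]
      simp only [RCLike.inner_apply, conj_trivial]
      ring
    rw [h2, EuclideanSpace.real_norm_sq_eq]
    linarith [hc h]
  rcases (norm_nonneg h).eq_or_lt with h0 | h0
  · rw [← h0]; exact norm_nonneg w
  · have := h1.trans (real_inner_le_norm h w)
    rw [pow_two] at this
    exact le_of_mul_le_mul_left this h0

/-- The partial trace of a solution of the system solves the reduced system `(1 + c) h = tr b`. -/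
theorem IsSystemSolution.partialTrace_add {c : Fin n → Fin n → ℝ}
    {b a : Fin n → Fin n → Fin n → ℝ} (ha : IsSystemSolution c b a) (i : Fin n) :
    partialTrace a i + ∑ k, c i k * partialTrace a k = partialTrace b i := by
  simp only [partialTrace_apply, ← Finset.sum_add_distrib]
  exact Finset.sum_congr rfl fun q _ => ha q i q

theorem IsAccretive.existsUnique_isSystemSolution {c : Fin n → Fin n → ℝ} (hc : IsAccretive c)
    (b : Fin n → Fin n → Fin n → ℝ) : ∃! a, IsSystemSolution c b a := by
  have huniq {h h' : E n} {w : E n} (hh : ∀ i, h i + ∑ k, c i k * h k = w i)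
      (hh' : ∀ i, h' i + ∑ k, c i k * h' k = w i) : h = h' := by
    have := hc.norm_le (h := h - h') (w := 0) fun i => by
      have := hh i
      rw [← hh' i] at this
      simp only [PiLp.sub_apply, mul_sub, Finset.sum_sub_distrib, PiLp.zero_apply]
      linarith
    rw [norm_zero] at this
    exact sub_eq_zero.1 (norm_le_zero_iff.1 this)
  let A : Matrix (Fin n) (Fin n) ℝ := 1 + Matrix.of c
  have hA (v : Fin n → ℝ) (i : Fin n) : A.mulVec v i = v i + ∑ k, c i k * v k := by
    simp [A, Matrix.mulVec, dotProduct, add_mul, Finset.sum_add_distrib, Matrix.one_apply]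
  have hinj : Function.Injective A.mulVec := fun v v' hvv => by
    have := huniq (h := WithLp.toLp 2 v) (h' := WithLp.toLp 2 v') (w := WithLp.toLp 2 (A.mulVec v))
      (fun i => (hA v i).symm) (fun i => by rw [hvv]; exact (hA v' i).symm)
    exact (WithLp.toLp_injective 2) this
  obtain ⟨h, hh⟩ := Matrix.mulVec_surjective_iff_isUnit.2 (Matrix.mulVec_injective_iff_isUnit.1 hinj)
    (partialTrace b).ofLp
  have hh' (i : Fin n) : h i + ∑ k, c i k * h k = partialTrace b i := by
    rw [← hA, hh]
  refine ⟨fun i j k => b i j k - c j k * h i, fun i j k => ?_, fun a ha => ?_⟩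
  · have : ∑ q, (b q i q - c i q * h q) = h i := by
      rw [Finset.sum_sub_distrib, ← partialTrace_apply, ← hh' i]
      ring
    rw [this]
    ring
  · have : partialTrace a = WithLp.toLp 2 h := huniq ha.partialTrace_add hh'
    ext i j k
    rw [← ha i j k, ← partialTrace_apply, this]
    simp

theorem isSystemSolution_systemSolution {c : Fin n → Fin n → ℝ} {b : Fin n → Fin n → Fin n → ℝ}
    (h : ∃! a, IsSystemSolution c b a) : IsSystemSolution c b (systemSolution c b) := by
  rw [systemSolution, dif_pos h]
  exact h.choose_spec.1

theorem norm_le_nat_mul_of_forall_le {z : E n} {C : ℝ} (hC : ∀ i, |z i| ≤ C) : ‖z‖ ≤ n * C := by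
  have h1 : z = ∑ i, z i • (EuclideanSpace.single i (1 : ℝ)) := by
    ext i
    simp [Finset.sum_apply, Pi.single_apply]
  calc ‖z‖ ≤ ∑ i : Fin n, ‖z i • (EuclideanSpace.single i (1 : ℝ) : E n)‖ := by
        conv_lhs => rw [h1]
        exact norm_sum_le _ _
    _ ≤ ∑ _i : Fin n, C := by
        refine Finset.sum_le_sum fun i _ => ?_
        simpa [norm_smul] using hC i
    _ = n * C := by simp

theorem abs_le_norm₂ (c : Fin n → Fin n → ℝ) (j k : Fin n) : |c j k| ≤ ‖c‖ :=
  (norm_le_pi_norm (c j) k).trans (norm_le_pi_norm c j)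

theorem abs_le_norm₃ (b : Fin n → Fin n → Fin n → ℝ) (i j k : Fin n) : |b i j k| ≤ ‖b‖ :=
  (abs_le_norm₂ (b i) j k).trans (norm_le_pi_norm b i)

/-- Lipschitz stability of the system: by accretivity the inverse of `1 + c'` is a contraction,
which controls the difference of the partial traces, and then the tensors themselves. -/
theorem IsSystemSolution.norm_sub_le_of_isAccretive {c c' : Fin n → Fin n → ℝ}
    {a b a' b' : Fin n → Fin n → Fin n → ℝ} (ha : IsSystemSolution c b a)
    (ha' : IsSystemSolution c' b' a') (hc : IsAccretive c) (hc' : IsAccretive c')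
    (hc1 : ∀ j k, |c' j k| ≤ 1) :
    ‖a' - a‖ ≤ (1 + (n : ℝ) ^ 2) * ‖b' - b‖ +
      (1 + (n : ℝ) ^ 2) * ‖partialTrace b‖ * ‖c' - c‖ := by
  set h := partialTrace a with hh
  set h' := partialTrace a' with hh'
  set β := ‖b' - b‖
  set γ := ‖c' - c‖
  have hnorm : ‖h‖ ≤ ‖partialTrace b‖ := hc.norm_le ha.partialTrace_add
  let w₂ : E n := WithLp.toLp 2 fun i => ∑ k, (c' - c) i k * h k
  have hw1 : ‖partialTrace (b' - b)‖ ≤ n * (n * β) := by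
    refine norm_le_nat_mul_of_forall_le fun i => ?_
    rw [partialTrace_apply]
    refine (Finset.abs_sum_le_sum_abs _ _).trans ?_
    have : ∀ q ∈ Finset.univ, |(b' - b) q i q| ≤ β := fun q _ => abs_le_norm₃ (b' - b) q i q
    refine (Finset.sum_le_sum this).trans ?_
    simp
  have hw2 : ‖w₂‖ ≤ n * (n * (γ * ‖h‖)) := by
    refine norm_le_nat_mul_of_forall_le fun i => ?_
    change |∑ k, (c' - c) i k * h k| ≤ _
    refine (Finset.abs_sum_le_sum_abs _ _).trans ?_
    have : ∀ k ∈ Finset.univ, |(c' - c) i k * h k| ≤ γ * ‖h‖ := fun k _ => by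
      rw [abs_mul]
      exact mul_le_mul (abs_le_norm₂ (c' - c) i k) (PiLp.norm_apply_le h k) (abs_nonneg _)
        (norm_nonneg _)
    refine (Finset.sum_le_sum this).trans ?_
    simp
  have hu : ‖h' - h‖ ≤ n * (n * β) + n * (n * (γ * ‖h‖)) := by
    refine (hc'.norm_le (w := partialTrace (b' - b) - w₂) fun i => ?_).trans
      ((norm_sub_le _ _).trans (add_le_add hw1 hw2))
    have e1 := ha.partialTrace_add i
    have e2 := ha'.partialTrace_add i
    have e3 : partialTrace (b' - b) i = partialTrace b' i - partialTrace b i := by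
      simp [Finset.sum_sub_distrib]
    rw [PiLp.sub_apply, PiLp.sub_apply, e3, ← e1, ← e2]
    simp only [PiLp.sub_apply, mul_sub, sub_mul, Finset.sum_sub_distrib, w₂, Pi.sub_apply]
    ring
  have hβ : 0 ≤ β := norm_nonneg _
  have hγ : 0 ≤ γ := norm_nonneg _
  have key : ∀ i j k, |(a' - a) i j k| ≤ β + (n * (n * β) + n * (n * (γ * ‖h‖))) + γ * ‖h‖ := by
    intro i j k
    have e1 := ha i j k
    have e2 := ha' i j k
    rw [← partialTrace_apply] at e1 e2
    have e3 : (a' - a) i j k = (b' - b) i j k - c' j k * (h' - h) i - (c' - c) j k * h i := by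
      simp only [Pi.sub_apply, PiLp.sub_apply]
      rw [← e1, ← e2]
      ring
    rw [e3]
    refine (abs_sub _ _).trans (add_le_add ((abs_sub _ _).trans (add_le_add ?_ ?_)) ?_)
    · exact abs_le_norm₃ _ _ _ _
    · rw [abs_mul]
      refine (mul_le_of_le_one_left (abs_nonneg _) (hc1 j k)).trans ?_
      exact (PiLp.norm_apply_le (h' - h) i).trans hu
    · rw [abs_mul]
      exact mul_le_mul (abs_le_norm₂ (c' - c) j k) (PiLp.norm_apply_le h i) (abs_nonneg _)
        (norm_nonneg _)
  have hpi : ‖a' - a‖ ≤ β + (n * (n * β) + n * (n * (γ * ‖h‖))) + γ * ‖h‖ := by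
    have h0 : 0 ≤ β + (n * (n * β) + n * (n * (γ * ‖h‖))) + γ * ‖h‖ := by positivity
    exact (pi_norm_le_iff_of_nonneg h0).2 fun i => (pi_norm_le_iff_of_nonneg h0).2 fun j =>
      (pi_norm_le_iff_of_nonneg h0).2 fun k => key i j k
  calc ‖a' - a‖ ≤ (1 + (n : ℝ) ^ 2) * β + (1 + (n : ℝ) ^ 2) * (‖h‖ * γ) := by linarith
    _ ≤ (1 + (n : ℝ) ^ 2) * β + (1 + (n : ℝ) ^ 2) * (‖partialTrace b‖ * γ) := by gcongr
    _ = _ := by ring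

end System

/-! ### Orthogonal projections -/

section Projection

variable {n d : ℕ}

theorem inner_e (v : E n) (i : Fin n) : inner ℝ v (e i) = v i := by
  simp [e, EuclideanSpace.inner_single_right]

theorem norm_apply_le_norm (S : Grassmannian d n) (v : E n) : ‖S.1 v‖ ≤ ‖v‖ := by
  refine (S.1.le_opNorm v).trans (mul_le_of_le_one_left (norm_nonneg _) ?_)
  exact IsStarProjection.norm_le S.1 S.2.1

theorem abs_entry_le_one (S : Grassmannian d n) (j k : Fin n) : |entry S j k| ≤ 1 := by
  refine (PiLp.norm_apply_le (S.1 (e k)) j).trans ((norm_apply_le_norm S _).trans ?_)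
  simp [e]

theorem continuous_entry (j k : Fin n) : Continuous fun S : Grassmannian d n => entry S j k := by
  unfold entry
  fun_prop

theorem sum_entry_mul (S : Grassmannian d n) (v : E n) (j : Fin n) :
    ∑ k, entry S j k * v k = S.1 v j := by
  have h1 : v = ∑ k, v k • e k := by
    ext i
    simp [e, Finset.sum_apply, Pi.single_apply]
  conv_rhs => rw [h1, map_sum]
  simp [entry, mul_comm]

theorem apply_apply (S : Grassmannian d n) (v : E n) : S.1 (S.1 v) = S.1 v :=
  congrArg (fun L : E n →L[ℝ] E n => L v) S.2.1.isIdempotentElem.eq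

theorem inner_apply_left (S : Grassmannian d n) (v w : E n) :
    inner ℝ (S.1 v) w = inner ℝ v (S.1 w) := by
  have h := S.2.1.isSelfAdjoint
  rw [ContinuousLinearMap.isSelfAdjoint_iff'] at h
  conv_lhs => rw [← h]
  rw [ContinuousLinearMap.adjoint_inner_left]

theorem isAccretive_entry (S : Grassmannian d n) : IsAccretive (entry S) := by
  intro v
  have h1 : ∑ i, v i * ∑ k, entry S i k * v k =
      inner ℝ (WithLp.toLp 2 v : E n) (S.1 (WithLp.toLp 2 v)) := by
    rw [PiLp.inner_apply]
    refine Finset.sum_congr rfl fun i _ => ?_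
    rw [← sum_entry_mul]
    simp only [RCLike.inner_apply, conj_trivial]
    ring
  rw [h1, ← apply_apply, ← inner_apply_left]
  exact real_inner_self_nonneg

/-- The tangential divergence of `φ e_i` is the `i`-th component of the tangential gradient. -/
theorem tangentialDivergence_smul_e (S : Grassmannian d n) {φ : E n → ℝ} {x : E n}
    (hφ : DifferentiableAt ℝ φ x) (i : Fin n) :
    tangentialDivergence S (fun y => φ y • e i) x = inner ℝ (tangentialGradient S φ x) (e i) := by
  have h1 : ((fderiv ℝ (fun y => φ y • (e i : E n)) x).comp S.1).toLinearMap =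
      ((fderiv ℝ φ x).comp S.1).toLinearMap.smulRight (e i) := by
    rw [fderiv_smul_const hφ]
    ext v
    simp
  rw [tangentialDivergence, h1, LinearMap.trace_smulRight, tangentialGradient, inner_apply_left,
    gradient, InnerProductSpace.toDual_symm_apply]
  rfl

end Projection

/-! ### Signed Radon measures as distributions -/

section Distribution

variable {n : ℕ} {Ω : Set (E n)}

/-- The test functions on `Ω`: functions of class `C¹` with compact support in `Ω`. -/
structure IsTestFunction (Ω : Set (E n)) (φ : E n → ℝ) : Prop where
  contDiff : ContDiff ℝ 1 φ
  hasCompactSupport : HasCompactSupport φ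
  tsupport_subset : tsupport φ ⊆ Ω

theorem IsTestFunction.integrable {φ : E n → ℝ} (hφ : IsTestFunction Ω φ) {μ : Measure (E n)}
    (hμ : IsRadonOn Ω μ) : Integrable φ μ := by
  obtain ⟨C, hC⟩ := hφ.contDiff.continuous.bounded_above_of_compact_support hφ.hasCompactSupport
  exact integrable_of_bounded_of_support hφ.contDiff.continuous.aestronglyMeasurable hC
    (fun y hy => image_eq_zero_of_notMem_tsupport hy)
    (hμ.compact_lt_top _ hφ.hasCompactSupport hφ.tsupport_subset)

theorem isTestFunction_scaledKernel {ρ : ℝ → ℝ} (hρ : ContDiffOn ℝ 1 ρ (Ici 0))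
    (h0 : derivWithin ρ (Ici 0) 0 = 0) (hp : IsProfile ρ) {ε : ℝ} (hε : 0 < ε) {x : E n}
    (hx : closedBall x ε ⊆ Ω) : IsTestFunction Ω fun y => scaledKernel ρ ε (y - x) := by
  have hs : ∀ y, y ∉ closedBall x ε → scaledKernel ρ ε (y - x) = 0 := fun y hy => by
    rw [mem_closedBall, dist_eq_norm, not_le] at hy
    exact hp.scaledKernel_eq_zero hε hy.le
  refine ⟨(contDiff_scaledKernel hρ h0 hε).comp (contDiff_id.sub contDiff_const),
    HasCompactSupport.intro (isCompact_closedBall x ε) (fun y hy => hs y hy), ?_⟩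
  refine (closure_minimal (fun y hy => ?_) isClosed_closedBall).trans hx
  by_contra hcon
  exact hy (hs y hcon)

/-- The mollifications of a signed Radon measure, relative to those of `ν`, converge to its density
with respect to `ν`, whichever pair of measures represents it. -/
theorem IsRadonDistribution.ae_tendsto_div (hΩ : IsOpen Ω) {ν : Measure (E n)}
    (hν : IsRadonOn Ω ν) {L : (E n → ℝ) → ℝ} (hL : IsRadonDistribution Ω L) {ρ : ℝ → ℝ}
    (hρ : ContDiffOn ℝ 1 ρ (Ici 0)) (h0 : derivWithin ρ (Ici 0) 0 = 0) (hp : IsProfile ρ)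
    (hanti : AntitoneOn ρ (Ici 0)) :
    ∀ᵐ x ∂ν, (∀ᶠ ε in 𝓝[>] (0 : ℝ), 0 < convolve ν (scaledKernel ρ ε) x) →
      Tendsto (fun ε => L (fun y => scaledKernel ρ ε (y - x)) / convolve ν (scaledKernel ρ ε) x)
        (𝓝[>] 0) (𝓝 (radonNikodymDensity Ω L ν x)) := by
  have hspec : IsRepresentedBy Ω L hL.choose := hL.choose_spec
  obtain ⟨h1, h2, hrep⟩ := hspec
  have := h1.sigmaFinite hΩ
  have := h2.sigmaFinite hΩ
  have := hν.sigmaFinite hΩ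
  filter_upwards [h1.ae_tendsto_rnDeriv hΩ hν, h2.ae_tendsto_rnDeriv hΩ hν,
    Measure.rnDeriv_ne_top hL.choose.1 ν, Measure.rnDeriv_ne_top hL.choose.2 ν,
    measure_eq_zero_iff_ae_notMem.1 hν.compl_null] with x l1 l2 t1 t2 hxΩ hpos
  rw [notMem_compl_iff] at hxΩ
  obtain ⟨R, hR, hRΩ⟩ := nhds_basis_closedBall.mem_iff.1 (hΩ.mem_nhds hxΩ)
  have hlt {μ : Measure (E n)} (hμ : IsRadonOn Ω μ) : μ (closedBall x R) < ∞ :=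
    hμ.compact_lt_top _ (isCompact_closedBall x R) hRΩ
  have k1 := hp.tendsto_convolve_div_convolve hanti t1 hR (hlt h1) (hlt hν) l1 hpos
  have k2 := hp.tendsto_convolve_div_convolve hanti t2 hR (hlt h2) (hlt hν) l2 hpos
  rw [radonNikodymDensity, dif_pos hL]
  refine (k1.sub k2).congr' ?_
  filter_upwards [Ioo_mem_nhdsGT hR] with ε hε
  have htest := isTestFunction_scaledKernel hρ h0 hp hε.1
    ((closedBall_subset_closedBall hε.2.le).trans hRΩ)
  rw [hrep _ htest.contDiff htest.hasCompactSupport htest.tsupport_subset, ← sub_div]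
  simp only [convolve, scaledKernel_sub_comm ρ ε x]

theorem IsRadonOn.sum {ι : Type*} {s : Finset ι} {μ : ι → Measure (E n)}
    (h : ∀ i, IsRadonOn Ω (μ i)) : IsRadonOn Ω (∑ i ∈ s, μ i) := by
  constructor
  · simp [Measure.finsetSum_apply, (h _).compl_null]
  · intro K hK hKΩ
    rw [Measure.finsetSum_apply]
    exact ENNReal.sum_lt_top.2 fun i _ => (h i).compact_lt_top K hK hKΩ

/-- A distribution that is a finite sum of signed Radon measures on test functions is one. -/
theorem IsRadonDistribution.of_eq_sum {ι : Type*} [Fintype ι] {L : ι → (E n → ℝ) → ℝ}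
    {L' : (E n → ℝ) → ℝ} (hL : ∀ i, IsRadonDistribution Ω (L i))
    (heq : ∀ φ, IsTestFunction Ω φ → L' φ = ∑ i, L i φ) : IsRadonDistribution Ω L' := by
  choose μ h1 h2 h3 using hL
  refine ⟨(∑ i, (μ i).1, ∑ i, (μ i).2), IsRadonOn.sum h1, IsRadonOn.sum h2,
    fun φ hφ hφs hφΩ => ?_⟩
  have hφt : IsTestFunction Ω φ := ⟨hφ, hφs, hφΩ⟩
  rw [heq φ hφt, integral_finsetSum_measure fun i _ => hφt.integrable (h1 i),
    integral_finsetSum_measure fun i _ => hφt.integrable (h2 i), ← Finset.sum_sub_distrib]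
  exact Finset.sum_congr rfl fun i _ => h3 i φ hφ hφs hφΩ

end Distribution

/-! ### Variations of a varifold -/

namespace Varifold

variable {d n : ℕ} {Ω : Set (E n)} (V : Varifold d Ω)

theorem isRadonOn_mass (hΩ : IsOpen Ω) : IsRadonOn Ω V.mass := by
  constructor
  · rw [mass, Measure.map_apply measurable_fst hΩ.measurableSet.compl, ← prod_univ]
    exact V.compl_null
  · intro K hK hKΩ
    rw [mass, Measure.map_apply measurable_fst hK.measurableSet, ← prod_univ]
    exact V.compact_lt_top K hK hKΩ

theorem integrable_variation_integrand {φ : E n → ℝ} (hφ : IsTestFunction Ω φ) (i j k : Fin n) :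
    Integrable (fun p : E n × Grassmannian d n =>
      entry p.2 j k * inner ℝ (tangentialGradient p.2 φ p.1) (e i)) V.measure := by
  have hgc : Continuous (gradient φ) :=
    (InnerProductSpace.toDual ℝ (E n)).symm.continuous.comp
      (hφ.contDiff.continuous_fderiv one_ne_zero)
  have hz : ∀ y, y ∉ tsupport φ → gradient φ y = 0 := fun y hy => by
    have : fderiv ℝ φ y = 0 := by
      by_contra hcon
      exact hy (support_fderiv_subset ℝ hcon)
    rw [gradient, this, map_zero]
  obtain ⟨C, hC⟩ := hgc.bounded_above_of_compact_support
    (HasCompactSupport.intro hφ.hasCompactSupport hz)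
  refine integrable_of_bounded_of_support (K := tsupport φ ×ˢ univ) (C := C)
    (Continuous.aestronglyMeasurable ?_) (fun p => ?_) (fun p hp => ?_)
    (V.compact_lt_top _ hφ.hasCompactSupport hφ.tsupport_subset)
  · have h1 : Continuous fun p : E n × Grassmannian d n => tangentialGradient p.2 φ p.1 :=
      (continuous_subtype_val.comp continuous_snd).clm_apply (hgc.comp continuous_fst)
    exact ((continuous_entry j k).comp continuous_snd).mul (h1.inner continuous_const)
  · rw [abs_mul, inner_e]
    refine (mul_le_of_le_one_left (abs_nonneg _) (abs_entry_le_one _ _ _)).trans ?_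
    exact (PiLp.norm_apply_le _ i).trans ((norm_apply_le_norm p.2 _).trans (hC p.1))
  · have : p.1 ∉ tsupport φ := fun h => hp ⟨h, mem_univ _⟩
    rw [tangentialGradient, hz _ this, map_zero, inner_zero_left, mul_zero]

/-- The first variation is a trace of the `G`-linear variation, because `S² = S`. -/
theorem firstVariation_smul_e {φ : E n → ℝ} (hφ : IsTestFunction Ω φ) (i : Fin n) :
    V.firstVariation (fun y => φ y • e i) = ∑ q, V.variation q i q φ := by
  simp only [firstVariation, variation]
  rw [← integral_finsetSum _ fun q _ => V.integrable_variation_integrand hφ q i q]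
  congr 1 with p
  rw [tangentialDivergence_smul_e _ (hφ.contDiff.differentiable one_ne_zero p.1)]
  simp only [inner_e]
  rw [sum_entry_mul, tangentialGradient, apply_apply]

theorem regVariationIntegrand_eq (ρ : ℝ → ℝ) (ε : ℝ) (x : E n) (i j k : Fin n)
    (p : E n × Grassmannian d n) :
    regVariationIntegrand ρ ε x i j k p =
      entry p.2 j k * inner ℝ (tangentialGradient p.2 (fun y => scaledKernel ρ ε (y - x)) p.1)
        (e i) := by
  rw [regVariationIntegrand, tangentialGradient, tangentialGradient, gradient, gradient,
    fderiv_comp_sub]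

theorem regVariation_eq (ρ : ℝ → ℝ) (ε : ℝ) (x : E n) (i j k : Fin n) :
    V.regVariation ρ ε i j k x = V.variation i j k (fun y => scaledKernel ρ ε (y - x)) := by
  simp only [regVariation, variation, regVariationIntegrand_eq]

/-! ### Young measures -/

open ProbabilityTheory

theorem restrict_compProd {α β : Type*} [MeasurableSpace α] [MeasurableSpace β] (μ : Measure α)
    [SFinite μ] (κ : Kernel α β) [IsSFiniteKernel κ] {K : Set α} (hK : MeasurableSet K) :
    (μ.restrict K).compProd κ = (μ.compProd κ).restrict (K ×ˢ univ) := by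
  ext s hs
  rw [Measure.restrict_apply hs, Measure.compProd_apply hs,
    Measure.compProd_apply (hs.inter (hK.prod .univ)), ← lintegral_indicator hK]
  refine lintegral_congr fun a => ?_
  by_cases ha : a ∈ K
  · rw [indicator_of_mem ha]
    congr 1
    ext b
    simp [ha]
  · rw [indicator_of_notMem ha]
    symm
    convert measure_empty (μ := κ a)
    ext b
    simp [ha]

instance : SecondCountableTopology (Grassmannian d n) := by
  have : ProperSpace (E n →L[ℝ] E n) := FiniteDimensional.proper ℝ _
  infer_instance

/-- If the varifold is carried by the graph of a field of planes, its Young measures are the Dirac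
masses at these planes. -/
theorem ae_c_eq_entry (hΩ : IsOpen Ω) {T : E n → Grassmannian d n} (hT : Measurable T)
    (hV : V.measure = V.mass.map fun x => (x, T x)) : ∀ᵐ x ∂V.mass, V.c x = entry (T x) := by
  have hm := V.isRadonOn_mass hΩ
  have := hm.sigmaFinite hΩ
  have hex : ∃ ν : Kernel (E n) (Grassmannian d n),
      IsMarkovKernel ν ∧ V.measure = V.mass.compProd ν :=
    ⟨Kernel.deterministic T hT, inferInstance, by rw [Measure.compProd_deterministic, ← hV]⟩
  have hy : V.young = hex.choose := dif_pos hex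
  obtain ⟨hMarkov, hdis⟩ := hex.choose_spec
  rw [← hy] at hMarkov hdis
  refine ae_of_ae_restrict_closedBall hΩ hm.compl_null fun x₀ r _ hr => ?_
  have := hm.isFiniteMeasure_restrict hr
  have h1 : (V.mass.restrict (closedBall x₀ r)).compProd V.young =
      (V.mass.restrict (closedBall x₀ r)).compProd (Kernel.deterministic T hT) := by
    rw [restrict_compProd _ _ measurableSet_closedBall,
      restrict_compProd _ _ measurableSet_closedBall, ← hdis, Measure.compProd_deterministic, ← hV]
  filter_upwards [Kernel.ae_eq_of_compProd_eq h1] with x hx _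
  ext j k
  rw [c, hx, Kernel.deterministic_apply,
    integral_dirac' _ _ (continuous_entry j k).stronglyMeasurable]

theorem IsRectifiable.exists_tangent (hV : V.IsRectifiable) :
    ∃ (M : Set (E n)) (θ : E n → ℝ≥0) (T : E n → Grassmannian d n), Measurable T ∧
      V.mass = weightedHausdorff d M θ ∧ V.measure = V.mass.map (fun x => (x, T x)) ∧
      ∀ᵐ x ∂V.mass, 0 < θ x ∧ IsApproxTangentSpace M θ x (T x) := by
  obtain ⟨M, θ, T, -, -, -, -, hT, hθ, hap, hmeas⟩ := hV
  have hmass : V.mass = weightedHausdorff d M θ := by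
    rw [mass, hmeas, Measure.map_map measurable_fst (by fun_prop)]
    exact Measure.map_id
  refine ⟨M, θ, T, hT, hmass, by rw [hmass, hmeas], ?_⟩
  rw [hmass]
  exact (withDensity_absolutelyContinuous _ _).ae_le (hθ.and hap)

end Varifold

/-! ### Regularized tensors -/

section Regularized

variable {d n : ℕ} {Ω : Set (E n)} {V : Varifold d Ω} {ρ ξ η : ℝ → ℝ} {T : E n → Grassmannian d n}

theorem eventually_mem_innerSet (hΩ : IsOpen Ω) {x : E n} (hx : x ∈ Ω) :
    ∀ᶠ ε in 𝓝[>] (0 : ℝ), x ∈ innerSet Ω ε := by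
  have hpos : 0 < infEDist x (frontier Ω) := by
    rw [infEDist_pos_iff_notMem_closure, isClosed_frontier.closure_eq, hΩ.frontier_eq]
    exact fun h => h.2 hx
  have hlim : Tendsto ENNReal.ofReal (𝓝[>] 0) (𝓝 0) := by
    have := (ENNReal.continuous_ofReal.tendsto 0).mono_left (nhdsWithin_le_nhds (s := Ioi 0))
    rwa [ENNReal.ofReal_zero] at this
  filter_upwards [hlim.eventually (gt_mem_nhds hpos)] with ε hε
  exact ⟨hx, hε⟩

namespace Varifold

theorem cReg_eq (hc : ∀ᵐ y ∂V.mass, V.c y = entry (T y)) (η : ℝ → ℝ) (ε : ℝ) (x : E n)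
    (j k : Fin n) : V.cReg η ε x j k =
      (∫ y, scaledKernel η ε (x - y) * entry (T y) j k ∂V.mass) /
        convolve V.mass (scaledKernel η ε) x := by
  rw [cReg]
  congr 1
  refine integral_congr_ae ?_
  filter_upwards [hc] with y hy
  rw [hy]

theorem integrable_scaledKernel_mul_c_iff (hc : ∀ᵐ y ∂V.mass, V.c y = entry (T y)) (η : ℝ → ℝ)
    (ε : ℝ) (x : E n) (j k : Fin n) :
    Integrable (fun y => scaledKernel η ε (x - y) * V.c y j k) V.mass ↔
      Integrable (fun y => scaledKernel η ε (x - y) * entry (T y) j k) V.mass := by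
  refine integrable_congr ?_
  filter_upwards [hc] with y hy
  rw [hy]

theorem isAccretive_cReg {ε : ℝ} {x : E n} (hη : IsProfile η) (hε : 0 < ε)
    (hc : ∀ᵐ y ∂V.mass, V.c y = entry (T y))
    (hint : ∀ j k, Integrable (fun y => scaledKernel η ε (x - y) * V.c y j k) V.mass)
    (hpos : 0 < convolve V.mass (scaledKernel η ε) x) : IsAccretive (V.cReg η ε x) := by
  intro v
  have hi (j k : Fin n) := (integrable_scaledKernel_mul_c_iff hc η ε x j k).1 (hint j k)
  have hi2 (j : Fin n) : Integrable
      (fun y => ∑ k, scaledKernel η ε (x - y) * entry (T y) j k * v k) V.mass :=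
    integrable_finsetSum _ fun k _ => (hi j k).mul_const _
  have key : ∑ j, v j * ∑ k, V.cReg η ε x j k * v k =
      (∫ y, scaledKernel η ε (x - y) * ∑ j, v j * ∑ k, entry (T y) j k * v k ∂V.mass) /
        convolve V.mass (scaledKernel η ε) x := by
    have h1 : ∫ y, scaledKernel η ε (x - y) * ∑ j, v j * ∑ k, entry (T y) j k * v k ∂V.mass =
        ∑ j, v j * ∑ k, (∫ y, scaledKernel η ε (x - y) * entry (T y) j k ∂V.mass) * v k := by
      simp_rw [← integral_mul_const]
      simp_rw [← integral_finsetSum _ fun k _ => (hi _ k).mul_const (v k)]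
      simp_rw [← integral_const_mul]
      rw [← integral_finsetSum _ fun j _ => (hi2 j).const_mul (v j)]
      congr 1 with y
      simp only [Finset.mul_sum]
      refine Finset.sum_congr rfl fun j _ => Finset.sum_congr rfl fun k _ => ?_
      ring
    rw [h1, Finset.sum_div]
    refine Finset.sum_congr rfl fun j _ => ?_
    rw [mul_div_assoc, Finset.sum_div]
    congr 1
    refine Finset.sum_congr rfl fun k _ => ?_
    rw [cReg_eq hc]
    ring
  rw [key]
  exact div_nonneg (integral_nonneg fun y =>
    mul_nonneg (hη.scaledKernel_nonneg hε _) (isAccretive_entry (T y) v)) hpos.le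

theorem RegularizationDefined.abs_cReg_le_one {ε : ℝ} {x : E n} (hη : IsProfile η) (hε : 0 < ε)
    (h : V.RegularizationDefined ρ ξ η ε x) (hc : ∀ᵐ y ∂V.mass, V.c y = entry (T y))
    (j k : Fin n) : |V.cReg η ε x j k| ≤ 1 := by
  rw [cReg_eq hc, abs_div, abs_of_pos h.eta_pos, div_le_one h.eta_pos]
  refine (abs_integral_le_integral_abs).trans ?_
  refine integral_mono
    ((integrable_scaledKernel_mul_c_iff hc η ε x j k).1 (h.integrable_c j k)).abs
    h.integrable_eta fun y => ?_
  change |_| ≤ _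
  rw [abs_mul, abs_of_nonneg (hη.scaledKernel_nonneg hε _)]
  exact mul_le_of_le_one_right (hη.scaledKernel_nonneg hε _) (abs_entry_le_one _ _ _)

end Varifold

theorem continuous_toB : Continuous (toB (n := n)) := by
  unfold toB
  fun_prop

end Regularized

end WeakCurvature

end

/-! ### Consistency of the regularized second fundamental form -/

open Metric WeakCurvature WeakCurvature.Varifold in
theorem mainTheorem3 (n d : ℕ) (hd : 1 ≤ d) (hdn : d ≤ n) :
    ∃ C₁ C₂ : ℝ, 0 < C₁ ∧ 0 < C₂ ∧
      ∀ (ρ ξ η : ℝ → ℝ), WeakCurvature.IsKernelTriple n ρ ξ η →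
      ∀ (Ω : Set (WeakCurvature.E n)), IsOpen Ω →
      ∀ (V : WeakCurvature.Varifold d Ω), V.IsRectifiable → V.HasBoundedVariations →
      ∀ᵐ x ∂V.mass,
        (∃! a, WeakCurvature.IsSystemSolution (V.c x) (V.beta x) a) ∧
        (∀ᶠ ε in 𝓝[>] (0 : ℝ), V.RegularizationDefined ρ ξ η ε x) ∧
        Tendsto (fun ε => V.betaReg ρ ξ ε x) (𝓝[>] 0) (𝓝 (V.beta x)) ∧
        Tendsto (fun ε => V.cReg η ε x) (𝓝[>] 0) (𝓝 (V.c x)) ∧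
        Tendsto (fun ε => V.AReg ρ ξ η ε x) (𝓝[>] 0) (𝓝 (V.A x)) ∧
        Tendsto (fun ε => V.BReg ρ ξ η ε x) (𝓝[>] 0) (𝓝 (V.B x)) ∧
        ∀ ε : ℝ, 0 < ε → V.RegularizationDefined ρ ξ η ε x →
          ‖V.AReg ρ ξ η ε x - V.A x‖ ≤
            C₁ * ‖V.betaReg ρ ξ ε x - V.beta x‖ +
              C₂ * ‖V.meanCurvature x‖ * ‖V.cReg η ε x - V.c x‖ := by
  refine ⟨1 + (n : ℝ) ^ 2, 1 + (n : ℝ) ^ 2, by positivity, by positivity, ?_⟩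
  intro ρ ξ η hK Ω hΩ V hV hBV
  obtain ⟨M, θ, T, hT, hmass, hmeas, htan⟩ := hV.exists_tangent
  have hR := V.isRadonOn_mass hΩ
  have hc := V.ae_c_eq_entry hΩ hT hmeas
  have hρ := hK.isProfile_rho
  have hξ := hK.isProfile_xi
  have hη := hK.isProfile_eta
  have hτ (j k : Fin n) : Measurable fun y => entry (T y) j k :=
    (continuous_entry j k).measurable.comp hT
  have hfirst (i : Fin n) :
      IsRadonDistribution Ω fun φ => V.firstVariation fun y => φ y • e i :=
    IsRadonDistribution.of_eq_sum (fun q => hBV q i q) fun φ hφ => V.firstVariation_smul_e hφ i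
  have hLvar : ∀ᵐ x ∂V.mass, ∀ i j k, _ := ae_all_iff.2 fun i => ae_all_iff.2 fun j =>
    ae_all_iff.2 fun k => (hBV i j k).ae_tendsto_div hΩ hR hK.rho_contDiff hK.rho_deriv_zero hρ
      hK.rho_antitone
  have hLfirst : ∀ᵐ x ∂V.mass, ∀ i, _ := ae_all_iff.2 fun i =>
    (hfirst i).ae_tendsto_div hΩ hR hK.rho_contDiff hK.rho_deriv_zero hρ hK.rho_antitone
  have hLeb : ∀ᵐ x ∂V.mass, ∀ j k, _ := ae_all_iff.2 fun j => ae_all_iff.2 fun k =>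
    hR.ae_tendsto_average_abs_sub hΩ (hτ j k) fun x => abs_entry_le_one (T x) j k
  filter_upwards [htan, hc, hLvar, hLfirst, hLeb,
    measure_eq_zero_iff_ae_notMem.1 hR.compl_null] with x hx hcx hvx hfx hlx hxΩ
  obtain ⟨hθx, hSx⟩ := hx
  rw [notMem_compl_iff] at hxΩ
  obtain ⟨R, hR0, hRΩ⟩ := nhds_basis_closedBall.mem_iff.1 (hΩ.mem_nhds hxΩ)
  have hRfin : V.mass (closedBall x R) < ∞ := hR.compact_lt_top _ (isCompact_closedBall x R) hRΩ
  have hρpos := hSx.eventually_convolve_pos hd hθx hρ hK.rho_nontrivial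
  have hξpos := hSx.eventually_convolve_pos hd hθx hξ hK.xi_nontrivial
  have hηpos := hSx.eventually_convolve_pos hd hθx hη hK.eta_nontrivial
  have hratio := hSx.tendsto_convolve_div hd hθx hρ hξ hK.xi_nontrivial
  rw [← hmass] at hρpos hξpos hηpos hratio
  have hCρ := kernelConstant_pos hρ hd hK.rho_nontrivial
  have hCξ := kernelConstant_pos hξ hd hK.xi_nontrivial
  have htest : ∀ᶠ ε in 𝓝[>] (0 : ℝ), IsTestFunction Ω fun y => scaledKernel ρ ε (y - x) := by
    filter_upwards [Ioo_mem_nhdsGT hR0] with ε hε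
    exact isTestFunction_scaledKernel hK.rho_contDiff hK.rho_deriv_zero hρ hε.1
      ((closedBall_subset_closedBall hε.2.le).trans hRΩ)
  have hacc : IsAccretive (V.c x) := by
    rw [hcx]
    exact isAccretive_entry (T x)
  have hex := hacc.existsUnique_isSystemSolution (V.beta x)
  -- convergence of the regularized variations
  have hbeta : Tendsto (fun ε => V.betaReg ρ ξ ε x) (𝓝[>] 0) (𝓝 (V.beta x)) := by
    refine tendsto_pi_nhds.2 fun i => tendsto_pi_nhds.2 fun j => tendsto_pi_nhds.2 fun k => ?_
    have h1 := (((hvx i j k hρpos).mul hratio).const_mul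
      (-(kernelConstant d ξ / kernelConstant d ρ)))
    have h2 : -(kernelConstant d ξ / kernelConstant d ρ) *
        (radonNikodymDensity Ω (V.variation i j k) V.mass x *
          (kernelConstant d ρ / kernelConstant d ξ)) = V.beta x i j k := by
      rw [Varifold.beta]
      field_simp
    rw [h2] at h1
    refine h1.congr' ?_
    filter_upwards [hρpos] with ε hε
    rw [betaReg, regVariation_eq, div_mul_div_cancel₀ hε.ne']
  -- convergence of the regularized projections
  have hcReg : Tendsto (fun ε => V.cReg η ε x) (𝓝[>] 0) (𝓝 (V.c x)) := by
    obtain ⟨D, hD⟩ := hSx.exists_closedBall_le hd hθx hη hK.eta_nontrivial hR0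
      (by rwa [← hmass])
    rw [← hmass] at hD
    refine tendsto_pi_nhds.2 fun j => tendsto_pi_nhds.2 fun k => ?_
    rw [hcx]
    refine (hη.tendsto_convolve_mul_div hR0 hRfin (hτ j k)
      (fun y => abs_entry_le_one (T y) j k) (hlx j k) (hηpos.and hD)).congr fun ε => ?_
    rw [cReg_eq hc]
  -- the trace of the density is the density of the trace
  have htrace : partialTrace (V.beta x) = V.meanCurvature x := by
    ext i
    have h1 : Tendsto (fun ε => ∑ q, V.variation q i q (fun y => scaledKernel ρ ε (y - x)) /
        convolve V.mass (scaledKernel ρ ε) x) (𝓝[>] 0)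
        (𝓝 (∑ q, radonNikodymDensity Ω (V.variation q i q) V.mass x)) :=
      tendsto_finsetSum _ fun q _ => hvx q i q hρpos
    have h2 := tendsto_nhds_unique h1 ((hfx i hρpos).congr' ?_)
    · simp only [partialTrace_apply, Varifold.beta, meanCurvature, Finset.sum_neg_distrib]
      rw [h2]
    · filter_upwards [htest] with ε hε
      rw [V.firstVariation_smul_e hε, Finset.sum_div]
  have hbound : ∀ ε : ℝ, 0 < ε → V.RegularizationDefined ρ ξ η ε x →
      ‖V.AReg ρ ξ η ε x - V.A x‖ ≤ (1 + (n : ℝ) ^ 2) * ‖V.betaReg ρ ξ ε x - V.beta x‖ +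
        (1 + (n : ℝ) ^ 2) * ‖V.meanCurvature x‖ * ‖V.cReg η ε x - V.c x‖ := by
    intro ε hε hdef
    rw [← htrace]
    exact (isSystemSolution_systemSolution hex).norm_sub_le_of_isAccretive
      (isSystemSolution_systemSolution hdef.existsUnique) hacc
      (isAccretive_cReg hη hε hc hdef.integrable_c hdef.eta_pos) (hdef.abs_cReg_le_one hη hε hc)
  have hdefined : ∀ᶠ ε in 𝓝[>] (0 : ℝ), V.RegularizationDefined ρ ξ η ε x := by
    filter_upwards [hξpos, hηpos, htest, eventually_mem_innerSet hΩ hxΩ,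
      Ioo_mem_nhdsGT hR0] with ε hξε hηε htε hinner hε
    have hfin : V.mass (closedBall x ε) < ∞ :=
      (measure_mono (closedBall_subset_closedBall hε.2.le)).trans_lt hRfin
    have hint (j k : Fin n) :
        Integrable (fun y => scaledKernel η ε (x - y) * V.c y j k) V.mass :=
      (integrable_scaledKernel_mul_c_iff hc η ε x j k).2
        (hη.integrable_scaledKernel_mul hε.1 hfin (hτ j k).aestronglyMeasurable
          fun y => abs_entry_le_one (T y) j k)
    exact ⟨hinner, fun i j k => by
      simpa only [← regVariationIntegrand_eq] using V.integrable_variation_integrand htε i j k,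
      hξ.integrable_scaledKernel hε.1 hfin, hη.integrable_scaledKernel hε.1 hfin, hint, hξε, hηε,
      (isAccretive_cReg hη hε.1 hc hint hηε).existsUnique_isSystemSolution _⟩
  have hA : Tendsto (fun ε => V.AReg ρ ξ η ε x) (𝓝[>] 0) (𝓝 (V.A x)) := by
    rw [tendsto_iff_norm_sub_tendsto_zero] at hbeta hcReg ⊢
    have hlim := (hbeta.const_mul (1 + (n : ℝ) ^ 2)).add
      (hcReg.const_mul ((1 + (n : ℝ) ^ 2) * ‖V.meanCurvature x‖))
    rw [mul_zero, mul_zero, add_zero] at hlim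
    refine squeeze_zero' (Eventually.of_forall fun _ => norm_nonneg _) ?_ hlim
    filter_upwards [hdefined, self_mem_nhdsWithin] with ε hdef hε
    exact hbound ε hε hdef
  exact ⟨hex, hdefined, hbeta, hcReg, hA, (continuous_toB.tendsto _).comp hA, hbound⟩
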